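/- Let $(X,d,\mu)$ be a metric measure space: a metric space with a non-negative Borel measure such that $0<\mu(B(x,r))<\infty$ for all $x\in X$, $r\in(0,\infty)$. **Exponents.** $\mathcal P(X)$ is the set of measurable $q:X\to(0,\infty]$ with $\operatorname{ess\,inf} q>0$; $\mathcal P_b(X)$ is the set of essentially bounded, finite-valued $p\in\mathcal P(X)$; $\mathcal P_b^{\log}(X)$ is the set of $p\in\mathcal P_b(X)$ for which there is $C>0$ with $|1/p(x)-1/p(y)|\le C/\log(e+1/d(x,y))$ for all $x\neq y$. Write $f\ll g$ if $\operatorname{ess\,inf}(g-f)>0$. **Function spaces.** For $p\in\mathcal P_b(X)$ put $\rho_{p(\cdot)}(u)=\int_X|u(x)|^{p(x)}\,d\mu(x)$, let $L^{p(\cdot)}(X)$ be the space of measurable, a.e. finite $u$ with $\rho_{p(\cdot)}(u)<\infty$, and $\|u\|_{L^{p(\cdot)}}=\inf\{\lambda>0:\rho_{p(\cdot)}(u/\lambda)\le1\}$. For sequences $g=\{g_k\}_{k\in\mathbb Z}$ of measurable functions and $q\in\mathcal P(X)$ put $\|g\|_{L^{p(\cdot)}(\ell^{q(\cdot)})}=\big\|\,\|\{g_k(\cdot)\}_k\|_{\ell^{q(\cdot)}}\big\|_{L^{p(\cdot)}}$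 and $\|g\|_{\ell^{q(\cdot)}(L^{p(\cdot)})}=\inf\{\lambda>0:\rho(g/\lambda)\le1\}$, where $\rho(g)=\sum_{k\in\mathbb Z}\inf\{\lambda_k>0:\rho_{p(\cdot)}(g_k/\lambda_k^{1/q(\cdot)})\le1\}$, with $\lambda^{1/\infty}=1$ and $\inf\emptyset=\infty$. For $s\in\mathcal P_b(X)$ and a measurable, a.e. finite $u:X\to[-\infty,\infty]$, let $\mathbb D^{s(\cdot)}(u)$ be the set of sequences $\{g_k\}_{k\in\mathbb Z}$ of measurable $g_k:X\to[0,\infty]$ for which there is a $\mu$-null set $N$ such that $$|u(x)-u(y)|\le d(x,y)^{s(x)}g_k(x)+d(x,y)^{s(y)}g_k(y)$$ for all $k\in\mathbb Z$ and $x,y\in X\setminus N$ with $2^{-k-1}\le d(x,y)<2^{-k}$. The Hajłasz–Triebel–Lizorkin space $M^{s(\cdot)}_{p(\cdot),q(\cdot)}(X,d,\mu)$ consists of all $u\in L^{p(\cdot)}(X)$ with finite quasi-norm $\|u\|_{L^{p(\cdot)}}+\inf_{g\in\mathbb D^{s(\cdot)}(u)}\|g\|_{L^{p(\cdot)}(\ell^{q(\cdot)})}$,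 and the Hajłasz–Besov space $N^{s(\cdot)}_{p(\cdot),q(\cdot)}(X,d,\mu)$ of all $u\in L^{p(\cdot)}(X)$ with finite quasi-norm $\|u\|_{L^{p(\cdot)}}+\inf_{g\in\mathbb D^{s(\cdot)}(u)}\|g\|_{\ell^{q(\cdot)}(L^{p(\cdot)})}$. For a bounded $\alpha:X\to[0,\infty)$, $C^{0,\alpha(\cdot)}(X,d)$ is the space of continuous $v:X\to\mathbb R$ with $$\|v\|_{C^{0,\alpha(\cdot)}}=\sup_{x}|v(x)|+\sup_{x\ne y}\frac{|v(x)-v(y)|}{d(x,y)^{\alpha(x)}}<\infty .$$ For a function space $V$ as above, $V\hookrightarrow C^{0,\alpha(\cdot)}(X,d)$ means that there is a constant $C$ such that every $u\in V$ agrees $\mu$-a.e. with some $v\in C^{0,\alpha(\cdot)}(X,d)$ satisfying $\|v\|_{C^{0,\alpha(\cdot)}}\le C\|u\|_V$. **Theorem.** Let $Q\in\mathcal P_b^{\log}(X)$ and suppose that $\mu$ is lower Ahlfors $Q(\cdot)$-regular, i.e. there is $b>0$ with $\mu(B(x,r))\ge b\,r^{Q(x)}$ for all $x\in X$, $r\in(0,1]$.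 Let $p,s\in\mathcal P_b^{\log}(X)$ with $Q\ll sp$. Then $\alpha:=s-Q/p$ is bounded and non-negative, and 1. for every $q\in\mathcal P(X)$, $M^{s(\cdot)}_{p(\cdot),q(\cdot)}(X,d,\mu)\hookrightarrow C^{0,\alpha(\cdot)}(X,d)$; 2. for every $q\in\mathcal P(X)$ with $q\le p$ on $X$, $N^{s(\cdot)}_{p(\cdot),q(\cdot)}(X,d,\mu)\hookrightarrow C^{0,\alpha(\cdot)}(X,d)$; 3. for every $q\in\mathcal P(X)$ and every $t\in\mathcal P_b^{\log}(X)$ with $Q\ll tp\ll sp$, the function $\lambda:=t-Q/p$ is bounded and non-negative, and $N^{s(\cdot)}_{p(\cdot),q(\cdot)}(X,d,\mu)\hookrightarrow C^{0,\lambda(\cdot)}(X,d)$. -/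

import Mathlib

open MeasureTheory
open scoped ENNReal NNReal

namespace VarExp

variable {X : Type*}

/-! ### Metric measure spaces and exponents -/

/-- `μ` makes the metric space `X` a metric measure space: every ball of positive finite radius
has positive and finite measure. -/
def IsMetricMeasure [MetricSpace X] [MeasurableSpace X] (μ : Measure X) : Prop :=
  ∀ (x : X) (r : ℝ), 0 < r → 0 < μ (Metric.ball x r) ∧ μ (Metric.ball x r) < ∞

/-- `μ` is lower Ahlfors `Q(·)`-regular. -/
def LowerAhlforsRegular [MetricSpace X] [MeasurableSpace X] (μ : Measure X) (Q : X → ℝ) : Prop :=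
  ∃ b : ℝ, 0 < b ∧ ∀ (x : X) (r : ℝ), 0 < r → r ≤ 1 →
    ENNReal.ofReal (b * r ^ Q x) ≤ μ (Metric.ball x r)

/-- The class `𝒫(X)`: measurable functions `q : X → (0, ∞]` whose essential infimum is
positive. -/
structure IsExponent [MeasurableSpace X] (μ : Measure X) (q : X → ℝ≥0∞) : Prop where
  measurable : Measurable q
  pos : ∀ x, 0 < q x
  essInf_pos : ∃ c : ℝ≥0∞, 0 < c ∧ ∀ᵐ x ∂μ, c ≤ q x

/-- The class `𝒫_b(X)` of (finite-valued) exponents which are essentially bounded and whose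
essential infimum is positive. -/
structure IsBddExponent [MeasurableSpace X] (μ : Measure X) (p : X → ℝ) : Prop where
  measurable : Measurable p
  pos : ∀ x, 0 < p x
  essInf_pos : ∃ c : ℝ, 0 < c ∧ ∀ᵐ x ∂μ, c ≤ p x
  essBdd : ∃ C : ℝ, ∀ᵐ x ∂μ, p x ≤ C

/-- Local log-Hölder continuity (for `x = y` the inequality is trivially true). -/
def LogHolder [MetricSpace X] (f : X → ℝ) : Prop :=
  ∃ C : ℝ, 0 < C ∧ ∀ x y : X, |f x - f y| ≤ C / Real.log (Real.exp 1 + 1 / dist x y)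

/-- The class `𝒫_b^log(X)`: exponents `p ∈ 𝒫_b(X)` such that `1/p` is locally log-Hölder
continuous. -/
structure IsBddLogExponent [MetricSpace X] [MeasurableSpace X] (μ : Measure X) (p : X → ℝ) : Prop
    extends IsBddExponent μ p where
  logHolder : LogHolder (fun x => 1 / p x)

/-- `f ≪ g`, i.e. the essential infimum of `g - f` is positive. -/
def MuchLess [MeasurableSpace X] (μ : Measure X) (f g : X → ℝ) : Prop :=
  ∃ c : ℝ, 0 < c ∧ ∀ᵐ x ∂μ, c ≤ g x - f x

/-! ### Variable exponent Lebesgue spaces and mixed Lebesgue-sequence spaces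

Functions enter through their absolute values, which take values in `[0, ∞]`. Quasi-norms take
values in `[0, ∞]`, with `inf ∅ = ∞`. -/

/-- The semi-modular `∫ |f|^{p(x)} dμ(x)`. -/
noncomputable def modular [MeasurableSpace X] (μ : Measure X) (p : X → ℝ) (f : X → ℝ≥0∞) : ℝ≥0∞ :=
  ∫⁻ x, f x ^ p x ∂μ

/-- The Luxemburg quasi-norm of `L^{p(·)}`. -/
noncomputable def lpNorm [MeasurableSpace X] (μ : Measure X) (p : X → ℝ) (f : X → ℝ≥0∞) : ℝ≥0∞ :=
  sInf {l : ℝ≥0∞ | 0 < l ∧ l < ∞ ∧ modular μ p (fun x => f x / l) ≤ 1}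

/-- The pointwise `ℓ^{q(x)}`-quasi-norm of a sequence. -/
noncomputable def seqNorm (q : ℝ≥0∞) (a : ℤ → ℝ≥0∞) : ℝ≥0∞ :=
  if q = ∞ then ⨆ k, a k else (∑' k, a k ^ q.toReal) ^ (1 / q.toReal)

/-- The quasi-norm of `L^{p(·)}(ℓ^{q(·)})`. -/
noncomputable def lpSeqNorm [MeasurableSpace X] (μ : Measure X) (p : X → ℝ) (q : X → ℝ≥0∞)
    (g : ℤ → X → ℝ≥0∞) : ℝ≥0∞ :=
  lpNorm μ p (fun x => seqNorm (q x) (fun k => g k x))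

/-- The semi-modular of `ℓ^{q(·)}(L^{p(·)})`, where `l^{1/∞} = 1`. -/
noncomputable def seqLpModular [MeasurableSpace X] (μ : Measure X) (p : X → ℝ) (q : X → ℝ≥0∞)
    (g : ℤ → X → ℝ≥0∞) : ℝ≥0∞ :=
  ∑' k, sInf {l : ℝ≥0∞ | 0 < l ∧ l < ∞ ∧
    modular μ p (fun x => g k x / l ^ ((q x)⁻¹).toReal) ≤ 1}

/-- The quasi-norm of `ℓ^{q(·)}(L^{p(·)})`. -/
noncomputable def seqLpNorm [MeasurableSpace X] (μ : Measure X) (p : X → ℝ) (q : X → ℝ≥0∞)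
    (g : ℤ → X → ℝ≥0∞) : ℝ≥0∞ :=
  sInf {l : ℝ≥0∞ | 0 < l ∧ l < ∞ ∧ seqLpModular μ p q (fun k x => g k x / l) ≤ 1}

/-- The space `L^{p(·)}(X, μ)`, as a set of extended-real-valued functions. -/
def LpSpace [MeasurableSpace X] (μ : Measure X) (p : X → ℝ) : Set (X → EReal) :=
  {u | Measurable u ∧ modular μ p (fun x => (u x).abs) < ∞}

/-! ### Hajłasz-Triebel-Lizorkin and Hajłasz-Besov spaces -/

/-- The set `𝔻^{s(·)}(u)` of vector `s(·)`-gradients of `u`. -/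
def vectorGradients [MetricSpace X] [MeasurableSpace X] (μ : Measure X) (s : X → ℝ)
    (u : X → EReal) : Set (ℤ → X → ℝ≥0∞) :=
  {g | (∀ k, Measurable (g k)) ∧ ∃ N : Set X, μ N = 0 ∧ ∀ (k : ℤ) (x y : X), x ∉ N → y ∉ N →
    (2 : ℝ) ^ (-k - 1) ≤ dist x y → dist x y < (2 : ℝ) ^ (-k) →
    (u x - u y).abs ≤
      ENNReal.ofReal (dist x y ^ s x) * g k x + ENNReal.ofReal (dist x y ^ s y) * g k y}

/-- The quasi-seminorm of the homogeneous Hajłasz-Triebel-Lizorkin space. -/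
noncomputable def homTriebelLizorkinNorm [MetricSpace X] [MeasurableSpace X] (μ : Measure X)
    (s p : X → ℝ) (q : X → ℝ≥0∞) (u : X → EReal) : ℝ≥0∞ :=
  ⨅ g ∈ vectorGradients μ s u, lpSeqNorm μ p q g

/-- The quasi-seminorm of the homogeneous Hajłasz-Besov space. -/
noncomputable def homBesovNorm [MetricSpace X] [MeasurableSpace X] (μ : Measure X)
    (s p : X → ℝ) (q : X → ℝ≥0∞) (u : X → EReal) : ℝ≥0∞ :=
  ⨅ g ∈ vectorGradients μ s u, seqLpNorm μ p q g

/-- The homogeneous Hajłasz-Triebel-Lizorkin space. -/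
def HomTriebelLizorkin [MetricSpace X] [MeasurableSpace X] (μ : Measure X)
    (s p : X → ℝ) (q : X → ℝ≥0∞) : Set (X → EReal) :=
  {u | Measurable u ∧ (∀ᵐ x ∂μ, u x ≠ ⊤ ∧ u x ≠ ⊥) ∧ homTriebelLizorkinNorm μ s p q u < ∞}

/-- The homogeneous Hajłasz-Besov space. -/
def HomBesov [MetricSpace X] [MeasurableSpace X] (μ : Measure X)
    (s p : X → ℝ) (q : X → ℝ≥0∞) : Set (X → EReal) :=
  {u | Measurable u ∧ (∀ᵐ x ∂μ, u x ≠ ⊤ ∧ u x ≠ ⊥) ∧ homBesovNorm μ s p q u < ∞}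

/-- The Hajłasz-Triebel-Lizorkin space `M^{s(·)}_{p(·),q(·)}(X, d, μ)`. -/
def TriebelLizorkin [MetricSpace X] [MeasurableSpace X] (μ : Measure X)
    (s p : X → ℝ) (q : X → ℝ≥0∞) : Set (X → EReal) :=
  HomTriebelLizorkin μ s p q ∩ LpSpace μ p

/-- The Hajłasz-Besov space `N^{s(·)}_{p(·),q(·)}(X, d, μ)`. -/
def Besov [MetricSpace X] [MeasurableSpace X] (μ : Measure X)
    (s p : X → ℝ) (q : X → ℝ≥0∞) : Set (X → EReal) :=
  HomBesov μ s p q ∩ LpSpace μ p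

/-- The quasi-norm of `M^{s(·)}_{p(·),q(·)}(X, d, μ)`. -/
noncomputable def triebelLizorkinNorm [MetricSpace X] [MeasurableSpace X] (μ : Measure X)
    (s p : X → ℝ) (q : X → ℝ≥0∞) (u : X → EReal) : ℝ≥0∞ :=
  lpNorm μ p (fun x => (u x).abs) + homTriebelLizorkinNorm μ s p q u

/-- The quasi-norm of `N^{s(·)}_{p(·),q(·)}(X, d, μ)`. -/
noncomputable def besovNorm [MetricSpace X] [MeasurableSpace X] (μ : Measure X)
    (s p : X → ℝ) (q : X → ℝ≥0∞) (u : X → EReal) : ℝ≥0∞ :=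
  lpNorm μ p (fun x => (u x).abs) + homBesovNorm μ s p q u

/-! ### Variable exponent Hölder spaces and embeddings -/

/-- The norm `sup |v| + [v]_{α(·)}` of `C^{0,α(·)}(X, d)`. -/
noncomputable def holderNorm [MetricSpace X] (α : X → ℝ) (v : X → ℝ) : ℝ≥0∞ :=
  (⨆ x, ENNReal.ofReal |v x|) +
    ⨆ (x : X) (y : X) (_ : x ≠ y), ENNReal.ofReal (|v x - v y| / dist x y ^ α x)

/-- The Hölder space `C^{0,α(·)}(X, d)`. -/
def HolderSpace [MetricSpace X] (α : X → ℝ) : Set (X → ℝ) :=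
  {v | Continuous v ∧ holderNorm α v < ∞}

/-- Continuous embedding into `C^{0,α(·)}(X, d)` of a space `V` of functions, identified when equal
almost everywhere, with quasi-norm `n`. The first two clauses say that `α` is an admissible
exponent, i.e. a bounded function `X → [0, ∞)`. -/
def EmbedsInHolder [MetricSpace X] [MeasurableSpace X] (μ : Measure X)
    (V : Set (X → EReal)) (n : (X → EReal) → ℝ≥0∞) (α : X → ℝ) : Prop :=
  (∀ x, 0 ≤ α x) ∧ BddAbove (Set.range α) ∧
  ∃ C : ℝ≥0, ∀ u ∈ V, ∃ v ∈ HolderSpace α,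
    (∀ᵐ x ∂μ, u x = (v x : EReal)) ∧ holderNorm α v ≤ C * n u

end VarExp

/-!
The argument is of Morrey type. Let `‖u‖_{p(·)}` and `‖h‖_{p(·)}` be at most `L`, where `h` is a
single function with `|u(x) - u(y)| ≤ d(x,y)^{s(x)} h(x) + d(x,y)^{s(y)} h(y)` for `d(x,y) < 1`.
By Markov's inequality and `μ(B(x,r)) ≥ b r^{Q(x)}`, every ball `B(x,r)` with `r ≤ 1` contains a
good point, at which `|u|` and `h` are at most `C L r^{-Q/p}`. The gradient inequality between the
good points of two balls of comparable radius then bounds the difference of their values by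
`C L r^{s - Q/p}`; the log-Hölder conditions make the exponents at points of distance at most `r`
interchangeable, up to a bounded factor. Since `s - Q/p` is bounded below by a positive constant,
the values at good points chosen at dyadic scales converge geometrically, to a Hölder continuous
function which equals `u` almost everywhere.

A sequence `g` of gradients is replaced by the single function `sup_{k ≥ 0} g_k`, whose
`L^{p(·)}` quasi-norm is controlled by that of `L^{p(·)}(ℓ^{q(·)})`, and by that of
`ℓ^{q(·)}(L^{p(·)})` if `q ≤ p`. For arbitrary `q`, lowering the smoothness from `s` to `t ≤ s - δ`
gains a factor `2^{-kδ}` at scale `k`, and these weights make the `L^{p(·)}` modulars of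
`2^{-kδ} g_k` summable.
-/

namespace VarExp

open Filter Set
open scoped Topology

variable {X : Type*}

section LogHolder

variable [MetricSpace X] {f g : X → ℝ} {A C M N c : ℝ}

theorem one_le_log_exp_one_add {t : ℝ} (ht : 0 ≤ t) : 1 ≤ Real.log (Real.exp 1 + t) := by
  rw [Real.le_log_iff_exp_le (by positivity)]
  linarith

theorem logHolder_of_le
    (h : ∀ x y, |f x - f y| ≤ C / Real.log (Real.exp 1 + 1 / dist x y)) : LogHolder f := by
  refine ⟨max C 1, by positivity, fun x y => (h x y).trans ?_⟩
  have := one_le_log_exp_one_add (t := 1 / dist x y) (by positivity)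
  gcongr
  exact le_max_left _ _

theorem LogHolder.sub (hf : LogHolder f) (hg : LogHolder g) : LogHolder fun x => f x - g x := by
  obtain ⟨C, -, hC⟩ := hf
  obtain ⟨D, -, hD⟩ := hg
  refine logHolder_of_le (C := C + D) fun x y => ?_
  rw [add_div, sub_sub_sub_comm]
  exact (abs_sub _ _).trans (add_le_add (hC x y) (hD x y))

theorem LogHolder.mul (hf : LogHolder f) (hg : LogHolder g) (hM : ∀ x, |f x| ≤ M)
    (hN : ∀ x, |g x| ≤ N) : LogHolder fun x => f x * g x := by
  obtain ⟨C, -, hC⟩ := hf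
  obtain ⟨D, -, hD⟩ := hg
  refine logHolder_of_le (C := N * C + M * D) fun x y => ?_
  have hM0 : 0 ≤ M := (abs_nonneg _).trans (hM x)
  have hN0 : 0 ≤ N := (abs_nonneg _).trans (hN x)
  calc |f x * g x - f y * g y| = |g x * (f x - f y) + f y * (g x - g y)| := by ring_nf
    _ ≤ |g x| * |f x - f y| + |f y| * |g x - g y| := by
      simpa only [abs_mul] using abs_add_le (g x * (f x - f y)) (f y * (g x - g y))
    _ ≤ N * (C / Real.log (Real.exp 1 + 1 / dist x y))
        + M * (D / Real.log (Real.exp 1 + 1 / dist x y)) := by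
      gcongr
      exacts [hN x, hC x y, hM y, hD x y]
    _ = (N * C + M * D) / Real.log (Real.exp 1 + 1 / dist x y) := by ring

theorem LogHolder.inv (hf : LogHolder f) (hc : 0 < c) (hcf : ∀ x, c ≤ |f x|) :
    LogHolder fun x => (f x)⁻¹ := by
  obtain ⟨C, -, hC⟩ := hf
  refine logHolder_of_le (C := C / (c * c)) fun x y => ?_
  have hx : f x ≠ 0 := abs_pos.1 (hc.trans_le (hcf x))
  have hy : f y ≠ 0 := abs_pos.1 (hc.trans_le (hcf y))
  rw [inv_sub_inv hx hy, abs_div, abs_mul, abs_sub_comm, div_right_comm]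
  have hC' := hC x y
  have hC0 := (abs_nonneg _).trans hC'
  gcongr
  exacts [hcf x, hcf y]

theorem LogHolder.continuous (hf : LogHolder f) : Continuous f := by
  obtain ⟨C, hC, h⟩ := hf
  refine Metric.continuous_iff.2 fun x ε hε => ⟨Real.exp (-(C / ε)), Real.exp_pos _, fun y hy => ?_⟩
  rcases eq_or_ne y x with rfl | hne
  · simpa using hε
  have hd : 0 < dist y x := dist_pos.2 hne
  have hexp : Real.exp (C / ε) < 1 / dist y x := by
    rw [lt_one_div (Real.exp_pos _) hd, one_div, ← Real.exp_neg]
    exact hy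
  have hlog : C / ε < Real.log (Real.exp 1 + 1 / dist y x) := by
    rw [Real.lt_log_iff_exp_lt (by positivity)]
    exact hexp.trans (lt_add_of_pos_left _ (Real.exp_pos 1))
  rw [Real.dist_eq]
  refine (h y x).trans_lt ?_
  rwa [div_lt_comm₀ (lt_trans (by positivity) hlog) hε]

/-- The powers `r ^ α x` and `r ^ α y` are comparable, with constant `A`, for all `r ∈ (0, 1]` and
`x`, `y` at distance at most `r`. This is the only form in which log-Hölder continuity enters the
estimates. -/
def IsRpowComparable (A : ℝ) (α : X → ℝ) : Prop :=
  ∀ ⦃x y : X⦄ ⦃r : ℝ⦄, 0 < r → r ≤ 1 → dist x y ≤ r → r ^ α x ≤ A * r ^ α y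

theorem LogHolder.exists_isRpowComparable (hf : LogHolder f) :
    ∃ A, 1 ≤ A ∧ IsRpowComparable A f := by
  obtain ⟨C, hC, h⟩ := hf
  refine ⟨Real.exp C, Real.one_le_exp hC.le, fun x y r hr hr1 hd => ?_⟩
  rcases eq_or_ne x y with rfl | hne
  · exact le_mul_of_one_le_left (Real.rpow_nonneg hr.le _) (Real.one_le_exp hC.le)
  have hd0 : 0 < dist x y := dist_pos.2 hne
  have hlog_nonneg : 0 ≤ -Real.log r := neg_nonneg.2 (Real.log_nonpos hr.le hr1)
  have hlog_pos : 0 < Real.log (Real.exp 1 + 1 / dist x y) :=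
    one_pos.trans_le (one_le_log_exp_one_add (by positivity))
  have hlog_le : -Real.log r ≤ Real.log (Real.exp 1 + 1 / dist x y) := by
    rw [← Real.log_inv, ← one_div]
    refine Real.log_le_log (by positivity) ((one_div_le_one_div_of_le hd0 hd).trans ?_)
    exact le_add_of_nonneg_left (Real.exp_pos 1).le
  have key : Real.log r * (f x - f y) ≤ C :=
    calc Real.log r * (f x - f y) = -Real.log r * (f y - f x) := by ring
      _ ≤ -Real.log r * |f x - f y| := by
        rw [abs_sub_comm]
        exact mul_le_mul_of_nonneg_left (le_abs_self _) hlog_nonneg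
      _ ≤ Real.log (Real.exp 1 + 1 / dist x y) *
          (C / Real.log (Real.exp 1 + 1 / dist x y)) := by
        gcongr
        exact h x y
      _ = C := mul_div_cancel₀ _ hlog_pos.ne'
  rw [Real.rpow_def_of_pos hr, Real.rpow_def_of_pos hr, ← Real.exp_add, Real.exp_le_exp]
  linarith

end LogHolder

section Dyadic

/-- The radii `2 ^ (-j - 2)`. They start at `1 / 4` so that points at distance less than
`dyadicRadius j` from two points at distance at most `dyadicRadius j` from each other have distance
less than `1`. -/
noncomputable def dyadicRadius (j : ℕ) : ℝ := 1 / 4 * (1 / 2) ^ j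

theorem dyadicRadius_pos (j : ℕ) : 0 < dyadicRadius j := by
  unfold dyadicRadius
  positivity

theorem dyadicRadius_le (j : ℕ) : dyadicRadius j ≤ 1 / 4 :=
  mul_le_of_le_one_right (by norm_num) (pow_le_one₀ (by norm_num) (by norm_num))

theorem dyadicRadius_le_one (j : ℕ) : dyadicRadius j ≤ 1 :=
  (dyadicRadius_le j).trans (by norm_num)

theorem dyadicRadius_succ (j : ℕ) : dyadicRadius (j + 1) = dyadicRadius j / 2 := by
  simp only [dyadicRadius, pow_succ]
  ring

theorem tendsto_dyadicRadius : Tendsto dyadicRadius atTop (𝓝 0) := by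
  have h := (tendsto_pow_atTop_nhds_zero_of_lt_one (r := (1 / 2 : ℝ)) (by norm_num)
    (by norm_num)).const_mul (1 / 4)
  rwa [mul_zero] at h

theorem dyadicRadius_rpow (j : ℕ) (β : ℝ) :
    dyadicRadius j ^ β = (1 / 4) ^ β * ((1 / 2) ^ β) ^ j := by
  rw [dyadicRadius, Real.mul_rpow (by norm_num) (by positivity), Real.rpow_pow_comm (by norm_num)]

theorem exists_dyadicRadius_mem_Icc {d : ℝ} (hd : 0 < d) (hd' : d ≤ 1 / 4) :
    ∃ j, dyadicRadius j ∈ Icc d (2 * d) := by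
  obtain ⟨j, hj, hj'⟩ := exists_nat_pow_near_of_lt_one (x := 4 * d) (y := (1 / 2 : ℝ))
    (by positivity) (by linarith) (by norm_num) (by norm_num)
  rw [pow_succ] at hj
  refine ⟨j, ?_, ?_⟩ <;> simp only [dyadicRadius] <;> linarith

theorem exists_tendsto_of_abs_sub_succ_le {c : ℕ → ℝ} {M a β : ℝ} (ha : 0 < a) (haβ : a ≤ β)
    (h : ∀ j, |c j - c (j + 1)| ≤ M * dyadicRadius j ^ β) :
    ∃ l, Tendsto c atTop (𝓝 l) ∧
      ∀ j, |c j - l| ≤ (1 - (1 / 2) ^ a)⁻¹ * (M * dyadicRadius j ^ β) := by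
  have hratio : ((1 : ℝ) / 2) ^ β ≤ (1 / 2) ^ a :=
    Real.rpow_le_rpow_of_exponent_ge (by norm_num) (by norm_num) haβ
  have ha1 : ((1 : ℝ) / 2) ^ a < 1 := Real.rpow_lt_one (by norm_num) (by norm_num) ha
  have hgeom : ∀ j, dist (c j) (c (j + 1)) ≤ M * (1 / 4) ^ β * ((1 / 2) ^ β) ^ j := fun j => by
    rw [Real.dist_eq, mul_assoc, ← dyadicRadius_rpow]
    exact h j
  have hlt : ((1 : ℝ) / 2) ^ β < 1 := hratio.trans_lt ha1
  obtain ⟨l, hl⟩ := cauchySeq_tendsto_of_complete (cauchySeq_of_le_geometric _ _ hlt hgeom)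
  refine ⟨l, hl, fun j => ?_⟩
  have hdist := dist_le_of_le_geometric_of_tendsto _ _ hlt hgeom hl j
  rw [Real.dist_eq, mul_assoc, ← dyadicRadius_rpow, div_eq_inv_mul] at hdist
  have hnonneg := (abs_nonneg _).trans (h j)
  refine hdist.trans ?_
  gcongr

end Dyadic

section IsHolderWith

variable [MetricSpace X] {α v : X → ℝ} {A E M S a : ℝ}

/-- Both the supremum and the `α(·)`-Hölder seminorm of `v` are at most `M`. -/
structure IsHolderWith (M : ℝ) (α v : X → ℝ) : Prop where
  abs_le : ∀ x, |v x| ≤ M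
  abs_sub_le : ∀ x y, |v x - v y| ≤ M * dist x y ^ α x

theorem IsHolderWith.holderNorm_le (h : IsHolderWith M α v) :
    holderNorm α v ≤ 2 * ENNReal.ofReal M := by
  rw [two_mul]
  refine add_le_add (iSup_le fun x => ENNReal.ofReal_le_ofReal (h.abs_le x))
    (iSup_le fun x => iSup_le fun y => iSup_le fun hxy => ENNReal.ofReal_le_ofReal ?_)
  have := dist_pos.2 hxy
  exact (div_le_iff₀ (by positivity)).2 (h.abs_sub_le x y)

theorem IsHolderWith.continuous (h : IsHolderWith M α v) (hα : ∀ x, 0 < α x) : Continuous v := by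
  refine continuous_iff_continuousAt.2 fun x => ?_
  have hdist : Tendsto (fun y => dist x y) (𝓝 x) (𝓝 0) :=
    (continuous_const.dist continuous_id).tendsto' x 0 (dist_self x)
  have hlim := (hdist.rpow_const (p := α x) (Or.inr (hα x).le)).const_mul M
  rw [Real.zero_rpow (hα x).ne', mul_zero] at hlim
  rw [ContinuousAt, tendsto_iff_dist_tendsto_zero]
  refine squeeze_zero (fun _ => dist_nonneg) (fun y => ?_) hlim
  rw [dist_comm, Real.dist_eq]
  exact h.abs_sub_le x y

theorem IsHolderWith.of_dist_le (hα : ∀ x, 0 ≤ α x) (hαS : ∀ x, α x ≤ S) (habs : ∀ x, |v x| ≤ M)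
    (hsub : ∀ x y, dist x y ≤ 1 / 4 → |v x - v y| ≤ M * dist x y ^ α x) :
    IsHolderWith (2 * 4 ^ S * M) α v := by
  have hM (x : X) : 0 ≤ M := (abs_nonneg _).trans (habs x)
  have h4 (x : X) : (1 : ℝ) ≤ 4 ^ S := Real.one_le_rpow (by norm_num) ((hα x).trans (hαS x))
  have hle (x : X) : M ≤ 2 * 4 ^ S * M :=
    le_mul_of_one_le_left (hM x) (by linarith [h4 x])
  refine ⟨fun x => (habs x).trans (hle x), fun x y => ?_⟩
  rcases le_or_gt (dist x y) (1 / 4) with hd | hd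
  · exact (hsub x y hd).trans (mul_le_mul_of_nonneg_right (hle x) (by positivity))
  have hone : 1 ≤ 4 ^ S * dist x y ^ α x :=
    calc (1 : ℝ) ≤ (4 * dist x y) ^ α x := Real.one_le_rpow (by linarith) (hα x)
      _ = 4 ^ α x * dist x y ^ α x := Real.mul_rpow (by norm_num) dist_nonneg
      _ ≤ 4 ^ S * dist x y ^ α x := by
        gcongr
        exacts [by norm_num, hαS x]
  calc |v x - v y| ≤ |v x| + |v y| := abs_sub _ _
    _ ≤ 2 * M * 1 := by linarith [habs x, habs y]
    _ ≤ 2 * M * (4 ^ S * dist x y ^ α x) :=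
      mul_le_mul_of_nonneg_left hone (by linarith [hM x])
    _ = 2 * 4 ^ S * M * dist x y ^ α x := by ring

/-- The functions `f j` approximate an `α(·)`-Hölder function at the scales `dyadicRadius j`: they
behave like its averages over balls of these radii. -/
structure IsHolderApprox (M : ℝ) (α : X → ℝ) (f : ℕ → X → ℝ) : Prop where
  abs_zero_le : ∀ x, |f 0 x| ≤ M
  abs_sub_succ_le : ∀ j x, |f j x - f (j + 1) x| ≤ M * dyadicRadius j ^ α x
  abs_sub_le : ∀ j x y, dist x y ≤ dyadicRadius j → |f j x - f j y| ≤ M * dyadicRadius j ^ α x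

theorem IsHolderApprox.abs_limit_le {f : ℕ → X → ℝ} (hf : IsHolderApprox M α f)
    (hα : ∀ x, 0 ≤ α x) (hE : 0 ≤ E)
    (hv : ∀ x j, |f j x - v x| ≤ E * (M * dyadicRadius j ^ α x)) (x : X) :
    |v x| ≤ (1 + E) * M := by
  have hM : 0 ≤ M := (abs_nonneg _).trans (hf.abs_zero_le x)
  have hr : dyadicRadius 0 ^ α x ≤ 1 :=
    Real.rpow_le_one (dyadicRadius_pos 0).le (dyadicRadius_le_one 0) (hα x)
  calc |v x| = |f 0 x - (f 0 x - v x)| := by rw [sub_sub_cancel]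
    _ ≤ |f 0 x| + |f 0 x - v x| := abs_sub _ _
    _ ≤ M + E * (M * 1) := by
      refine add_le_add (hf.abs_zero_le x) ((hv x 0).trans ?_)
      gcongr
    _ = (1 + E) * M := by ring

theorem IsHolderApprox.abs_limit_sub_le {f : ℕ → X → ℝ} (hf : IsHolderApprox M α f)
    (hA : IsRpowComparable A α) (hα : ∀ x, 0 ≤ α x) (hαS : ∀ x, α x ≤ S) (hE : 0 ≤ E)
    (hA0 : 0 ≤ A) (hv : ∀ x j, |f j x - v x| ≤ E * (M * dyadicRadius j ^ α x)) {x y : X}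
    (hd : dist x y ≤ 1 / 4) :
    |v x - v y| ≤ (1 + E + E * A) * 2 ^ S * M * dist x y ^ α x := by
  have hM : 0 ≤ M := (abs_nonneg _).trans (hf.abs_zero_le x)
  rcases eq_or_ne x y with rfl | hne
  · rw [sub_self, abs_zero]
    positivity
  obtain ⟨j, hj, hj'⟩ := exists_dyadicRadius_mem_Icc (dist_pos.2 hne) hd
  have hr := dyadicRadius_pos j
  have hcomp : dyadicRadius j ^ α y ≤ A * dyadicRadius j ^ α x :=
    hA hr (dyadicRadius_le_one j) (by rwa [dist_comm])
  have hrad : dyadicRadius j ^ α x ≤ 2 ^ S * dist x y ^ α x :=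
    calc dyadicRadius j ^ α x ≤ (2 * dist x y) ^ α x := by gcongr; exact hα x
      _ = 2 ^ α x * dist x y ^ α x := Real.mul_rpow zero_le_two dist_nonneg
      _ ≤ 2 ^ S * dist x y ^ α x := by
        gcongr
        exacts [one_le_two, hαS x]
  calc |v x - v y| = |(f j x - f j y) - (f j x - v x) + (f j y - v y)| := by ring_nf
    _ ≤ |f j x - f j y| + |f j x - v x| + |f j y - v y| :=
      (abs_add_le _ _).trans (add_le_add_left (abs_sub _ _) _)
    _ ≤ M * dyadicRadius j ^ α x + E * (M * dyadicRadius j ^ α x) +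
        E * (M * (A * dyadicRadius j ^ α x)) := by
      refine add_le_add (add_le_add (hf.abs_sub_le j x y hj) (hv x j)) ((hv y j).trans ?_)
      gcongr
    _ = (1 + E + E * A) * M * dyadicRadius j ^ α x := by ring
    _ ≤ (1 + E + E * A) * M * (2 ^ S * dist x y ^ α x) := by gcongr
    _ = (1 + E + E * A) * 2 ^ S * M * dist x y ^ α x := by ring

theorem IsHolderApprox.exists_isHolderWith_limit (hA1 : 1 ≤ A) (hA : IsRpowComparable A α)
    (ha : 0 < a) (haα : ∀ x, a ≤ α x) (hαS : ∀ x, α x ≤ S) :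
    ∃ C, 0 < C ∧ ∀ (M : ℝ) (f : ℕ → X → ℝ), IsHolderApprox M α f →
      ∃ v, (∀ x, Tendsto (fun j => f j x) atTop (𝓝 (v x))) ∧ IsHolderWith (C * M) α v := by
  set E : ℝ := (1 - (1 / 2) ^ a)⁻¹
  have hE : 0 < E :=
    inv_pos.2 (sub_pos.2 (Real.rpow_lt_one (by norm_num) (by norm_num) ha))
  refine ⟨2 * 4 ^ S * ((1 + E + E * A) * 2 ^ S), by positivity, fun M f hf => ?_⟩
  choose v hlim hv using fun x =>
    exists_tendsto_of_abs_sub_succ_le ha (haα x) fun j => hf.abs_sub_succ_le j x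
  have hα (x : X) : 0 ≤ α x := ha.le.trans (haα x)
  refine ⟨v, hlim, ?_⟩
  rw [mul_assoc _ _ M]
  refine IsHolderWith.of_dist_le hα hαS (fun x => ?_)
    fun x y => hf.abs_limit_sub_le hA hα hαS hE.le (by positivity) hv
  have hM : 0 ≤ M := (abs_nonneg _).trans (hf.abs_zero_le x)
  have h2 : (1 : ℝ) ≤ 2 ^ S := Real.one_le_rpow one_le_two ((hα x).trans (hαS x))
  calc |v x| ≤ (1 + E) * M := hf.abs_limit_le hα hE.le hv x
    _ = (1 + E + 0) * 1 * M := by ring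
    _ ≤ (1 + E + E * A) * 2 ^ S * M := by
      gcongr
      positivity

end IsHolderWith

section GoodPoints

variable [MetricSpace X] {s φ w H : X → ℝ} {G : Set X} {A K S a r r' ρ : ℝ} {x x' y y' : X}

/-- `H` is a real-valued Hajłasz `s(·)`-gradient of `w` on `G`, at distances less than `1`. -/
def IsHajlaszGradientOn (s w H : X → ℝ) (G : Set X) : Prop :=
  ∀ ⦃x⦄, x ∈ G → ∀ ⦃y⦄, y ∈ G → dist x y < 1 →
    |w x - w y| ≤ dist x y ^ s x * H x + dist x y ^ s y * H y

/-- `y` is a point of `G` in the ball of radius `r` about `x` at which `|w|` and `H` obey the bound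
`K * r ^ (-φ y)` that Markov's inequality provides when `φ = Q / p`. -/
structure IsGoodPoint (φ w H : X → ℝ) (G : Set X) (K r : ℝ) (x y : X) : Prop where
  mem : y ∈ G
  dist_lt : dist y x < r
  abs_le : |w y| ≤ K * r ^ (-φ y)
  le : H y ≤ K * r ^ (-φ y)

theorem IsGoodPoint.rpow_mul_le (h : IsGoodPoint φ w H G K r x y)
    (hA : IsRpowComparable A fun x => s x - φ x) (hs : ∀ x, 0 ≤ s x) (hsS : ∀ x, s x ≤ S)
    (hK : 0 ≤ K) (hr : 0 < r) (hr1 : r ≤ 1) (hρ : 0 ≤ ρ) (hρr : ρ ≤ 4 * r) :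
    ρ ^ s y * H y ≤ 4 ^ S * A * K * r ^ (s x - φ x) :=
  calc ρ ^ s y * H y ≤ ρ ^ s y * (K * r ^ (-φ y)) := by gcongr; exact h.le
    _ ≤ (4 * r) ^ s y * (K * r ^ (-φ y)) := by gcongr; exact hs y
    _ = 4 ^ s y * K * r ^ (s y - φ y) := by
      rw [Real.mul_rpow (by norm_num) hr.le, sub_eq_add_neg, Real.rpow_add hr]
      ring
    _ ≤ 4 ^ S * K * (A * r ^ (s x - φ x)) := by
      gcongr
      exacts [by norm_num, hsS y, hA hr hr1 h.dist_lt.le]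
    _ = 4 ^ S * A * K * r ^ (s x - φ x) := by ring

theorem IsGoodPoint.abs_sub_le (hG : IsHajlaszGradientOn s w H G)
    (h : IsGoodPoint φ w H G K r x y) (h' : IsGoodPoint φ w H G K r' x' y')
    (hA : IsRpowComparable A fun x => s x - φ x) (hs : ∀ x, 0 ≤ s x) (hsS : ∀ x, s x ≤ S)
    (hK : 0 ≤ K) (hr : 0 < r) (hr1 : r ≤ 1) (hr' : 0 < r') (hr1' : r' ≤ 1)
    (hd : dist y y' < 1) (hdr : dist y y' ≤ 4 * r) (hdr' : dist y y' ≤ 4 * r') :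
    |w y - w y'| ≤ 4 ^ S * A * K * (r ^ (s x - φ x) + r' ^ (s x' - φ x')) := by
  rw [mul_add]
  exact (hG h.mem h'.mem hd).trans <| add_le_add
    (h.rpow_mul_le hA hs hsS hK hr hr1 dist_nonneg hdr)
    (h'.rpow_mul_le hA hs hsS hK hr' hr1' dist_nonneg hdr')

theorem tendsto_of_isGoodPoint {c : ℕ → X} (hG : IsHajlaszGradientOn s w H G)
    (hA : IsRpowComparable A fun x => s x - φ x) (hφ : ∀ x, 0 ≤ φ x) (hφs : ∀ x, φ x < s x)
    (hsS : ∀ x, s x ≤ S) (hK : 0 ≤ K) (hx : x ∈ G)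
    (hc : ∀ j, IsGoodPoint φ w H G K (dyadicRadius j) x (c j)) :
    Tendsto (fun j => w (c j)) atTop (𝓝 (w x)) := by
  have hs (x : X) : 0 < s x := (hφ x).trans_lt (hφs x)
  have hlim : Tendsto (fun j => 4 ^ S * A * K * dyadicRadius j ^ (s x - φ x) +
      dyadicRadius j ^ s x * |H x|) atTop (𝓝 0) := by
    have h₁ := (tendsto_dyadicRadius.rpow_const (p := s x - φ x)
      (Or.inr (sub_pos.2 (hφs x)).le)).const_mul (4 ^ S * A * K)
    have h₂ := (tendsto_dyadicRadius.rpow_const (p := s x) (Or.inr (hs x).le)).mul_const |H x|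
    have h := h₁.add h₂
    rwa [Real.zero_rpow (sub_pos.2 (hφs x)).ne', Real.zero_rpow (hs x).ne', mul_zero, zero_mul,
      add_zero] at h
  rw [tendsto_iff_dist_tendsto_zero]
  refine squeeze_zero (fun _ => dist_nonneg) (fun j => ?_) hlim
  have hr := dyadicRadius_pos j
  have hd := (hc j).dist_lt
  rw [Real.dist_eq]
  refine (hG (hc j).mem hx (hd.trans_le (dyadicRadius_le_one j))).trans (add_le_add ?_ ?_)
  · exact (hc j).rpow_mul_le hA (fun x => (hs x).le) hsS hK hr (dyadicRadius_le_one j)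
      dist_nonneg (by linarith)
  · have hpow : dist (c j) x ^ s x ≤ dyadicRadius j ^ s x :=
      Real.rpow_le_rpow dist_nonneg hd.le (hs x).le
    exact (mul_le_mul_of_nonneg_left (le_abs_self (H x)) (by positivity)).trans
      (mul_le_mul_of_nonneg_right hpow (abs_nonneg _))

theorem IsGoodPoint.abs_le_of_dyadicRadius_zero
    (h : IsGoodPoint φ w H G K (dyadicRadius 0) x y) (hφ : φ y ≤ S) (hK : 0 ≤ K) :
    |w y| ≤ 4 ^ S * K := by
  have hr : dyadicRadius 0 = 4⁻¹ := by norm_num [dyadicRadius]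
  calc |w y| ≤ K * dyadicRadius 0 ^ (-φ y) := h.abs_le
    _ = K * 4 ^ φ y := by
      rw [hr, Real.inv_rpow (by norm_num), Real.rpow_neg (by norm_num), inv_inv]
    _ ≤ K * 4 ^ S := by
      gcongr
      norm_num
    _ = 4 ^ S * K := mul_comm _ _

theorem isHolderApprox_of_isGoodPoint {c : X → ℕ → X} (hG : IsHajlaszGradientOn s w H G)
    (hA1 : 1 ≤ A) (hA : IsRpowComparable A fun x => s x - φ x) (hφ : ∀ x, 0 ≤ φ x)
    (hφs : ∀ x, φ x < s x) (hsS : ∀ x, s x ≤ S) (hK : 0 ≤ K)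
    (hc : ∀ x j, IsGoodPoint φ w H G K (dyadicRadius j) x (c x j)) :
    IsHolderApprox (4 ^ S * A * (1 + A) * K) (fun x => s x - φ x) fun j x => w (c x j) := by
  have hs (x : X) : 0 ≤ s x := (hφ x).trans (hφs x).le
  have hα (x : X) : 0 ≤ s x - φ x := (sub_pos.2 (hφs x)).le
  refine ⟨fun x => ?_, fun j x => ?_, fun j x x' hd => ?_⟩
  · calc |w (c x 0)| ≤ 4 ^ S * K :=
        (hc x 0).abs_le_of_dyadicRadius_zero ((hφs _).le.trans (hsS _)) hK
      _ = 4 ^ S * 1 * (1 + 0) * K := by ring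
      _ ≤ 4 ^ S * A * (1 + A) * K := by gcongr; linarith
  · have hr := dyadicRadius_pos j
    have hr1 := dyadicRadius_le j
    have hsucc := dyadicRadius_succ j
    have hd := (hc x j).dist_lt
    have hd' := (hc x (j + 1)).dist_lt
    have htri := dist_triangle_right (c x j) (c x (j + 1)) x
    have hpow : dyadicRadius (j + 1) ^ (s x - φ x) ≤ A * dyadicRadius j ^ (s x - φ x) :=
      (Real.rpow_le_rpow (dyadicRadius_pos _).le (by linarith) (hα x)).trans
        (le_mul_of_one_le_left (by positivity) hA1)
    calc |w (c x j) - w (c x (j + 1))|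
        ≤ 4 ^ S * A * K * (dyadicRadius j ^ (s x - φ x) + dyadicRadius (j + 1) ^ (s x - φ x)) :=
          (hc x j).abs_sub_le hG (hc x (j + 1)) hA hs hsS hK hr (by linarith)
            (by linarith) (by linarith) (by linarith) (by linarith) (by linarith)
      _ ≤ 4 ^ S * A * K * (dyadicRadius j ^ (s x - φ x) + A * dyadicRadius j ^ (s x - φ x)) := by
        gcongr
      _ = 4 ^ S * A * (1 + A) * K * dyadicRadius j ^ (s x - φ x) := by ring
  · have hr := dyadicRadius_pos j
    have hr1 := dyadicRadius_le j
    have hdx := (hc x j).dist_lt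
    have hdx' := (hc x' j).dist_lt
    have htri := dist_triangle4_right (c x j) (c x' j) x x'
    have hpow : dyadicRadius j ^ (s x' - φ x') ≤ A * dyadicRadius j ^ (s x - φ x) :=
      hA hr (dyadicRadius_le_one j) (by rwa [dist_comm])
    calc |w (c x j) - w (c x' j)|
        ≤ 4 ^ S * A * K * (dyadicRadius j ^ (s x - φ x) + dyadicRadius j ^ (s x' - φ x')) :=
          (hc x j).abs_sub_le hG (hc x' j) hA hs hsS hK hr (by linarith) hr (by linarith)
            (by linarith) (by linarith) (by linarith)
      _ ≤ 4 ^ S * A * K * (dyadicRadius j ^ (s x - φ x) + A * dyadicRadius j ^ (s x - φ x)) := by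
        gcongr
      _ = 4 ^ S * A * (1 + A) * K * dyadicRadius j ^ (s x - φ x) := by ring

theorem exists_isHolderWith_of_good_points (hα : LogHolder fun x => s x - φ x) (ha : 0 < a)
    (haα : ∀ x, a ≤ s x - φ x) (hφ : ∀ x, 0 ≤ φ x) (hsS : ∀ x, s x ≤ S) :
    ∃ C, 0 < C ∧ ∀ (K : ℝ) (w H : X → ℝ) (G : Set X), 0 ≤ K → IsHajlaszGradientOn s w H G →
      (∀ x r, 0 < r → r ≤ 1 → ∃ y, IsGoodPoint φ w H G K r x y) →
      ∃ v, (∀ x ∈ G, v x = w x) ∧ IsHolderWith (C * K) (fun x => s x - φ x) v := by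
  obtain ⟨A, hA1, hA⟩ := hα.exists_isRpowComparable
  obtain ⟨C, hC, hlimit⟩ := IsHolderApprox.exists_isHolderWith_limit hA1 hA ha haα
    (S := S) fun x => by linarith [hφ x, hsS x]
  have hφs (x : X) : φ x < s x := sub_pos.1 (ha.trans_le (haα x))
  refine ⟨C * (4 ^ S * A * (1 + A)), by positivity, fun K w H G hK hG hgood => ?_⟩
  choose c hc using fun x j =>
    hgood x (dyadicRadius j) (dyadicRadius_pos j) (dyadicRadius_le_one j)
  obtain ⟨v, hlim, hv⟩ := hlimit _ _ (isHolderApprox_of_isGoodPoint hG hA1 hA hφ hφs hsS hK hc)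
  rw [← mul_assoc] at hv
  exact ⟨v, fun x hx => tendsto_nhds_unique (hlim x)
    (tendsto_of_isGoodPoint hG hA hφ hφs hsS hK hx (hc x)), hv⟩

end GoodPoints

section Exponents

variable [MeasurableSpace X] {μ : Measure X} {Q f p s : X → ℝ} {q : X → ℝ≥0∞}

theorem MuchLess.exists_le_sub_div (h : MuchLess μ f fun x => s x * p x)
    (hp : IsBddExponent μ p) : ∃ a, 0 < a ∧ ∀ᵐ x ∂μ, a ≤ s x - f x / p x := by
  obtain ⟨c, hc, hcf⟩ := h
  obtain ⟨C, hC⟩ := hp.essBdd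
  refine ⟨c / max C 1, by positivity, ?_⟩
  filter_upwards [hcf, hC] with x hx hxC
  have hpx := hp.pos x
  calc c / max C 1 ≤ (s x * p x - f x) / p x := by
        gcongr
        exacts [hc.le.trans hx, hxC.trans (le_max_left _ _)]
    _ = s x - f x / p x := by rw [sub_div, mul_div_cancel_right₀ _ hpx.ne']

theorem IsExponent.exists_inv_le (hq : IsExponent μ q) :
    ∃ κ : ℝ, 0 ≤ κ ∧ ∀ᵐ x ∂μ, (q x)⁻¹.toReal ≤ κ := by
  obtain ⟨c, hc, hcq⟩ := hq.essInf_pos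
  refine ⟨c⁻¹.toReal, ENNReal.toReal_nonneg, hcq.mono fun x hx => ?_⟩
  exact ENNReal.toReal_mono (ENNReal.inv_ne_top.2 hc.ne') (ENNReal.inv_le_inv.2 hx)

theorem forall_of_ae_of_isClosed [TopologicalSpace X] [μ.IsOpenPosMeasure] {P : X → Prop}
    (hP : IsClosed {x | P x}) (h : ∀ᵐ x ∂μ, P x) (x : X) : P x :=
  hP.closure_subset (Measure.dense_of_ae h x)

variable [MetricSpace X]

theorem LowerAhlforsRegular.isOpenPosMeasure (h : LowerAhlforsRegular μ Q) :
    μ.IsOpenPosMeasure := by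
  obtain ⟨b, hb, h⟩ := h
  refine ⟨fun U hU ⟨x, hx⟩ => ?_⟩
  obtain ⟨ε, hε, hball⟩ := Metric.isOpen_iff.1 hU x hx
  have hr : 0 < min ε 1 := lt_min hε one_pos
  have hpos : 0 < ENNReal.ofReal (b * min ε 1 ^ Q x) := ENNReal.ofReal_pos.2 (by positivity)
  refine (hpos.trans_le ((h x _ hr (min_le_right _ _)).trans (measure_mono ?_))).ne'
  exact (Metric.ball_subset_ball (min_le_left _ _)).trans hball

theorem IsBddLogExponent.continuous (hp : IsBddLogExponent μ p) : Continuous p := by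
  have h := hp.logHolder.continuous.inv₀ fun x => (one_div_pos.2 (hp.pos x)).ne'
  exact h.congr fun x => by simp only [Pi.inv_apply, one_div, inv_inv]

theorem IsBddLogExponent.exists_bounds [μ.IsOpenPosMeasure] (hp : IsBddLogExponent μ p) :
    ∃ c C, 0 < c ∧ 0 < C ∧ ∀ x, c ≤ p x ∧ p x ≤ C := by
  obtain ⟨c, hc, hcp⟩ := hp.essInf_pos
  obtain ⟨C, hpC⟩ := hp.essBdd
  refine ⟨c, max C 1, hc, by positivity, fun x => ⟨?_, le_max_of_le_left ?_⟩⟩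
  · exact forall_of_ae_of_isClosed (isClosed_le continuous_const hp.continuous) hcp x
  · exact forall_of_ae_of_isClosed (isClosed_le hp.continuous continuous_const) hpC x

theorem IsBddLogExponent.logHolder_self [μ.IsOpenPosMeasure] (hp : IsBddLogExponent μ p) :
    LogHolder p := by
  obtain ⟨_, C, -, hC, hpC⟩ := hp.exists_bounds
  have h := hp.logHolder.inv (one_div_pos.2 hC) fun x => by
    rw [abs_of_pos (one_div_pos.2 (hp.pos x))]
    exact one_div_le_one_div_of_le (hp.pos x) (hpC x).2
  simpa only [one_div, inv_inv] using h

theorem IsBddLogExponent.logHolder_sub_div [μ.IsOpenPosMeasure] (hs : IsBddLogExponent μ s)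
    (hQ : IsBddLogExponent μ Q) (hp : IsBddLogExponent μ p) :
    LogHolder fun x => s x - Q x / p x := by
  obtain ⟨_, M, -, -, hQM⟩ := hQ.exists_bounds
  obtain ⟨c, _, hc, -, hcp⟩ := hp.exists_bounds
  have hmul := hQ.logHolder_self.mul hp.logHolder
    (fun x => by rw [abs_of_pos (hQ.pos x)]; exact (hQM x).2)
    (N := 1 / c) fun x => by
      rw [abs_of_pos (one_div_pos.2 (hp.pos x))]
      exact one_div_le_one_div_of_le hc (hcp x).1
  simpa only [mul_one_div] using hs.logHolder_self.sub hmul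

theorem IsBddLogExponent.exists_le_sub_div [μ.IsOpenPosMeasure] (hs : IsBddLogExponent μ s)
    (hQ : IsBddLogExponent μ Q) (hp : IsBddLogExponent μ p)
    (h : MuchLess μ Q fun x => s x * p x) : ∃ a, 0 < a ∧ ∀ x, a ≤ s x - Q x / p x := by
  obtain ⟨a, ha, haα⟩ := h.exists_le_sub_div hp.toIsBddExponent
  exact ⟨a, ha, forall_of_ae_of_isClosed
    (isClosed_le continuous_const (hs.logHolder_sub_div hQ hp).continuous) haα⟩

end Exponents

section GoodPointsExist

variable [MeasurableSpace X] {μ : Measure X}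

theorem exists_mem_lt_of_lintegral_lt {g : X → ℝ≥0∞} {S G : Set X} {ε : ℝ≥0∞}
    (hg : Measurable g) (h : ∫⁻ x, g x ∂μ < ε * μ S) (hG : ∀ᵐ x ∂μ, x ∈ G) :
    ∃ y ∈ S, y ∈ G ∧ g y < ε := by
  by_contra! hcon
  refine h.not_ge (le_trans ?_ (mul_meas_ge_le_lintegral hg ε))
  exact mul_le_mul' le_rfl (measure_mono_ae <| hG.mono fun x hxG hxS => hcon x hxS hxG)

theorem le_ofReal_of_rpow_le {t : ℝ≥0∞} {M P c r β : ℝ} (hc : 0 < c) (hcP : c ≤ P)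
    (hM : 1 ≤ M) (hr : 0 < r) (h : t ^ P ≤ ENNReal.ofReal (M * r ^ (-β))) :
    t ≤ ENNReal.ofReal (M ^ (1 / c) * r ^ (-(β / P))) := by
  have hP : 0 < P := hc.trans_le hcP
  rw [← ENNReal.le_rpow_inv_iff hP, ENNReal.ofReal_rpow_of_pos (by positivity),
    Real.mul_rpow (by positivity) (by positivity), ← Real.rpow_mul hr.le, neg_mul,
    ← div_eq_mul_inv, ← one_div] at h
  refine h.trans (ENNReal.ofReal_le_ofReal ?_)
  gcongr

variable [MetricSpace X] {Q p : X → ℝ} {A c : ℝ}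

theorem LowerAhlforsRegular.exists_le_of_lintegral_le (hreg : LowerAhlforsRegular μ Q)
    (hA : IsRpowComparable A Q) (I : ℝ≥0) :
    ∃ M : ℝ, 1 ≤ M ∧ ∀ g : X → ℝ≥0∞, Measurable g → ∫⁻ x, g x ∂μ ≤ I →
      ∀ G : Set X, (∀ᵐ x ∂μ, x ∈ G) → ∀ x r, 0 < r → r ≤ 1 →
        ∃ y ∈ G, dist y x < r ∧ g y ≤ ENNReal.ofReal (M * r ^ (-Q y)) := by
  obtain ⟨b, hb, hreg⟩ := hreg
  refine ⟨max 1 ((I + 1) * A / b), le_max_left _ _, fun g hg hI G hG x r hr hr1 => ?_⟩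
  have hlt : ∫⁻ x, g x ∂μ < ENNReal.ofReal ((I + 1) / (b * r ^ Q x)) * μ (Metric.ball x r) :=
    calc ∫⁻ x, g x ∂μ ≤ I := hI
      _ < ENNReal.ofReal (I + 1) := by
        rw [← ENNReal.ofReal_coe_nnreal]
        exact (ENNReal.ofReal_lt_ofReal_iff (by positivity)).2 (lt_add_one _)
      _ = ENNReal.ofReal ((I + 1) / (b * r ^ Q x)) * ENNReal.ofReal (b * r ^ Q x) := by
        rw [← ENNReal.ofReal_mul (by positivity), div_mul_cancel₀ _ (by positivity)]
      _ ≤ _ := by gcongr; exact hreg x r hr hr1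
  obtain ⟨y, hy, hyG, hgy⟩ := exists_mem_lt_of_lintegral_lt hg hlt hG
  refine ⟨y, hyG, hy, hgy.le.trans (ENNReal.ofReal_le_ofReal ?_)⟩
  rw [Real.rpow_neg hr.le, ← div_eq_mul_inv, div_le_div_iff₀ (by positivity) (by positivity)]
  calc (I + 1) * r ^ Q y ≤ (I + 1) * (A * r ^ Q x) := by
        gcongr
        exact hA hr hr1 (Metric.mem_ball.1 hy).le
    _ = (I + 1) * A / b * (b * r ^ Q x) := by field_simp
    _ ≤ max 1 ((I + 1) * A / b) * (b * r ^ Q x) := by gcongr; exact le_max_right _ _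

theorem LowerAhlforsRegular.exists_le_of_modular_le_one (hreg : LowerAhlforsRegular μ Q)
    (hA : IsRpowComparable A Q) (hpm : Measurable p) (hc : 0 < c)
    (hcp : ∀ x, c ≤ p x) :
    ∃ K : ℝ, 0 < K ∧ ∀ f h : X → ℝ≥0∞, Measurable f → Measurable h →
      modular μ p f ≤ 1 → modular μ p h ≤ 1 → ∀ G : Set X, (∀ᵐ x ∂μ, x ∈ G) →
      ∀ x r, 0 < r → r ≤ 1 → ∃ y ∈ G, dist y x < r ∧
        f y ≤ ENNReal.ofReal (K * r ^ (-(Q y / p y))) ∧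
        h y ≤ ENNReal.ofReal (K * r ^ (-(Q y / p y))) := by
  obtain ⟨M, hM, hpoint⟩ := hreg.exists_le_of_lintegral_le hA 2
  refine ⟨M ^ (1 / c), by positivity, fun f h hf hh hf1 hh1 G hG x r hr hr1 => ?_⟩
  have hsum : ∫⁻ y, f y ^ p y + h y ^ p y ∂μ ≤ (2 : ℝ≥0) := by
    rw [lintegral_add_left (hf.pow hpm), ENNReal.coe_ofNat, ← one_add_one_eq_two]
    exact add_le_add hf1 hh1
  obtain ⟨y, hyG, hyd, hy⟩ :=
    hpoint _ ((hf.pow hpm).add (hh.pow hpm)) hsum G hG x r hr hr1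
  exact ⟨y, hyG, hyd, le_ofReal_of_rpow_le hc (hcp y) hM hr (le_self_add.trans hy),
    le_ofReal_of_rpow_le hc (hcp y) hM hr (le_add_self.trans hy)⟩

end GoodPointsExist

section Modular

variable [MeasurableSpace X] {μ : Measure X} {p : X → ℝ} {f g : X → ℝ≥0∞} {c : ℝ}

theorem modular_mono (hp : ∀ x, 0 ≤ p x) (h : ∀ x, f x ≤ g x) : modular μ p f ≤ modular μ p g :=
  lintegral_mono fun x => ENNReal.rpow_le_rpow (h x) (hp x)

theorem modular_mul_le {a : X → ℝ≥0∞} {M : ℝ≥0∞} (hp : ∀ x, 0 ≤ p x) (hM : M ≠ ∞)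
    (ha : ∀ᵐ x ∂μ, a x ^ p x ≤ M) : modular μ p (fun x => a x * f x) ≤ M * modular μ p f := by
  rw [modular, modular, ← lintegral_const_mul' _ _ hM]
  refine lintegral_mono_ae (ha.mono fun x hx => ?_)
  rw [ENNReal.mul_rpow_of_nonneg _ _ (hp x)]
  gcongr

theorem modular_const_mul_le {a : ℝ≥0∞} (ha : a ≤ 1) (hc : 0 ≤ c) (hcp : ∀ x, c ≤ p x) :
    modular μ p (fun x => a * f x) ≤ a ^ c * modular μ p f :=
  modular_mul_le (fun x => hc.trans (hcp x))
    ((ENNReal.rpow_le_one ha hc).trans_lt ENNReal.one_lt_top).ne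
    (.of_forall fun x => ENNReal.rpow_le_rpow_of_exponent_ge ha (hcp x))

theorem modular_div_rpow_le_one {m : ℝ≥0∞} (hc : 0 < c) (hcp : ∀ x, c ≤ p x) (hm : 1 ≤ m)
    (h : modular μ p f ≤ m) : modular μ p (fun x => f x / m ^ c⁻¹) ≤ 1 := by
  have hle : (m ^ c⁻¹)⁻¹ ≤ 1 := ENNReal.inv_le_one.2 (ENNReal.one_le_rpow hm (inv_pos.2 hc))
  calc modular μ p (fun x => f x / m ^ c⁻¹) = modular μ p fun x => (m ^ c⁻¹)⁻¹ * f x := by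
        simp only [div_eq_mul_inv, mul_comm]
    _ ≤ ((m ^ c⁻¹)⁻¹) ^ c * modular μ p f := modular_const_mul_le hle hc.le hcp
    _ = m⁻¹ * modular μ p f := by rw [ENNReal.inv_rpow, ENNReal.rpow_inv_rpow hc.ne']
    _ ≤ m⁻¹ * m := by gcongr
    _ ≤ 1 := ENNReal.inv_mul_le_one m

theorem iSup_rpow_le_tsum {ι : Type*} {P : ℝ} (hP : 0 < P) (a : ι → ℝ≥0∞) :
    (⨆ i, a i) ^ P ≤ ∑' i, a i ^ P :=
  (ENNReal.le_rpow_inv_iff hP).1 <|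
    iSup_le fun i => (ENNReal.le_rpow_inv_iff hP).2 (ENNReal.le_tsum i)

theorem modular_iSup_le {ι : Type*} [Countable ι] {f : ι → X → ℝ≥0∞} (hpm : Measurable p)
    (hp : ∀ x, 0 < p x) (hf : ∀ i, Measurable (f i)) :
    modular μ p (fun x => ⨆ i, f i x) ≤ ∑' i, modular μ p (f i) := by
  simp only [modular]
  rw [← lintegral_tsum fun i => ((hf i).pow hpm).aemeasurable]
  exact lintegral_mono fun x => iSup_rpow_le_tsum (hp x) fun i => f i x

theorem modular_iSup_pow_mul_le {f : ℕ → X → ℝ≥0∞} {τ : ℝ≥0∞} (hpm : Measurable p) (hc : 0 < c)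
    (hcp : ∀ x, c ≤ p x) (hτ : τ ≤ 1) (hf : ∀ k, Measurable (f k))
    (h : ∀ k, modular μ p (f k) ≤ 1) :
    modular μ p (fun x => ⨆ k, τ ^ k * f k x) ≤ (1 - τ ^ c)⁻¹ :=
  calc modular μ p (fun x => ⨆ k, τ ^ k * f k x)
      ≤ ∑' k, modular μ p fun x => τ ^ k * f k x :=
        modular_iSup_le hpm (fun x => hc.trans_le (hcp x)) fun k => (hf k).const_mul _
    _ ≤ ∑' k : ℕ, (τ ^ c) ^ k := ENNReal.tsum_le_tsum fun k => by
        refine (modular_const_mul_le (pow_le_one₀ zero_le hτ) hc.le hcp).trans ?_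
        have hpow : (τ ^ k) ^ c = (τ ^ c) ^ k := by
          rw [← ENNReal.rpow_natCast, ← ENNReal.rpow_mul, mul_comm, ENNReal.rpow_mul,
            ENNReal.rpow_natCast]
        rw [hpow]
        exact mul_le_of_le_one_right' (h k)
    _ = (1 - τ ^ c)⁻¹ := ENNReal.tsum_geometric _

theorem ae_ne_top_of_modular_ne_top (hpm : Measurable p) (hp : ∀ x, 0 < p x) (hf : Measurable f)
    (h : modular μ p f ≠ ∞) : ∀ᵐ x ∂μ, f x ≠ ∞ := by
  filter_upwards [ae_lt_top (hf.pow hpm) h] with x hx hxtop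
  rw [hxtop, ENNReal.top_rpow_of_pos (hp x)] at hx
  exact lt_irrefl _ hx

theorem modular_div_le_one_of_lpNorm_lt {L : ℝ≥0∞} (hp : ∀ x, 0 ≤ p x)
    (h : lpNorm μ p f < L) : modular μ p (fun x => f x / L) ≤ 1 := by
  obtain ⟨l, ⟨-, -, hl⟩, hlL⟩ := sInf_lt_iff.1 h
  exact (modular_mono hp fun x => ENNReal.div_le_div_left hlL.le _).trans hl

theorem lpNorm_mono (hp : ∀ x, 0 ≤ p x) (h : ∀ x, f x ≤ g x) : lpNorm μ p f ≤ lpNorm μ p g :=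
  sInf_le_sInf fun _ ⟨h₀, htop, hl⟩ =>
    ⟨h₀, htop, (modular_mono hp fun x => ENNReal.div_le_div_right (h x) _).trans hl⟩

theorem lpNorm_lt_top_of_modular_lt_top (hc : 0 < c) (hcp : ∀ x, c ≤ p x)
    (h : modular μ p f < ∞) : lpNorm μ p f < ∞ := by
  have htop : max 1 (modular μ p f) ^ c⁻¹ < ∞ :=
    ENNReal.rpow_lt_top_of_nonneg (inv_nonneg.2 hc.le) (max_lt ENNReal.one_lt_top h).ne
  refine lt_of_le_of_lt (sInf_le ⟨?_, htop, ?_⟩) htop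
  · exact ENNReal.rpow_pos (one_pos.trans_le (le_max_left _ _)) (max_lt ENNReal.one_lt_top h).ne
  · exact modular_div_rpow_le_one hc hcp (le_max_left _ _) (le_max_right _ _)

theorem modular_eq_zero_of_lpNorm_eq_zero (hc : 0 < c) (hcp : ∀ x, c ≤ p x)
    (h : lpNorm μ p f = 0) : modular μ p f = 0 := by
  refine nonpos_iff_eq_zero.1 (le_of_forall_gt_imp_ge_of_dense fun ε hε => ?_)
  set l : ℝ≥0∞ := min 1 (ε ^ c⁻¹)
  have hl0 : 0 < l :=
    lt_min one_pos (ENNReal.rpow_pos_of_nonneg hε (inv_nonneg.2 hc.le))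
  have hl1 : l ≤ 1 := min_le_left _ _
  have hltop : l ≠ ∞ := (hl1.trans_lt ENNReal.one_lt_top).ne
  calc modular μ p f = modular μ p fun x => l * (f x / l) := by
        simp only [ENNReal.mul_div_cancel hl0.ne' hltop]
    _ ≤ l ^ c * modular μ p (fun x => f x / l) := modular_const_mul_le hl1 hc.le hcp
    _ ≤ (ε ^ c⁻¹) ^ c * 1 := by
        gcongr
        · exact min_le_right _ _
        · exact modular_div_le_one_of_lpNorm_lt (fun x => hc.le.trans (hcp x)) (h ▸ hl0)
    _ = ε := by rw [mul_one, ENNReal.rpow_inv_rpow hc.ne']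

theorem ae_eq_zero_of_lpNorm_eq_zero (hpm : Measurable p) (hc : 0 < c) (hcp : ∀ x, c ≤ p x)
    (hf : Measurable f) (h : lpNorm μ p f = 0) : f =ᵐ[μ] 0 := by
  have hmod := modular_eq_zero_of_lpNorm_eq_zero hc hcp h
  rw [modular, lintegral_eq_zero_iff (hf.pow hpm)] at hmod
  exact hmod.mono fun x hx => (ENNReal.rpow_eq_zero_iff_of_pos (hc.trans_le (hcp x))).1 hx

end Modular

section MixedNorms

variable [MeasurableSpace X] {μ : Measure X} {p : X → ℝ} {q : X → ℝ≥0∞} {g : ℤ → X → ℝ≥0∞}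
  {c κ : ℝ}

theorem le_seqNorm {q : ℝ≥0∞} (hq : 0 < q) (a : ℤ → ℝ≥0∞) (k : ℤ) : a k ≤ seqNorm q a := by
  rw [seqNorm]
  split_ifs with h
  · exact le_iSup a k
  · rw [one_div, ENNReal.le_rpow_inv_iff (ENNReal.toReal_pos hq.ne' h)]
    exact ENNReal.le_tsum k

theorem lpNorm_iSup_le_lpSeqNorm (hp : ∀ x, 0 ≤ p x) (hq : ∀ x, 0 < q x) :
    lpNorm μ p (fun x => ⨆ k : ℕ, g k x) ≤ lpSeqNorm μ p q g :=
  lpNorm_mono hp fun x => iSup_le fun k => le_seqNorm (hq x) (fun k => g k x) k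

theorem exists_scales_of_seqLpModular_le_one (h : seqLpModular μ p q g ≤ 1) :
    ∃ l : ℤ → ℝ≥0∞, (∀ k, 0 < l k) ∧ ∑' k, l k ≤ 2 ∧
      ∀ k, modular μ p (fun x => g k x / l k ^ (q x)⁻¹.toReal) ≤ 1 := by
  obtain ⟨ε, hε, hεsum⟩ := ENNReal.exists_pos_sum_of_countable' one_ne_zero ℤ
  have hscale (k : ℤ) : ∃ l : ℝ≥0∞, 0 < l ∧
      l ≤ sInf {l | 0 < l ∧ l < ∞ ∧ modular μ p (fun x => g k x / l ^ (q x)⁻¹.toReal) ≤ 1} + ε k ∧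
      modular μ p (fun x => g k x / l ^ (q x)⁻¹.toReal) ≤ 1 := by
    have hfin : sInf {l : ℝ≥0∞ | 0 < l ∧ l < ∞ ∧
        modular μ p (fun x => g k x / l ^ (q x)⁻¹.toReal) ≤ 1} ≠ ∞ :=
      (((ENNReal.le_tsum k).trans h).trans_lt ENNReal.one_lt_top).ne
    obtain ⟨l, ⟨hl0, -, hl⟩, hlt⟩ := sInf_lt_iff.1 (ENNReal.lt_add_right hfin (hε k).ne')
    exact ⟨l, hl0, hlt.le, hl⟩
  choose l hl0 hlle hl using hscale
  refine ⟨l, hl0, (ENNReal.tsum_le_tsum hlle).trans ?_, hl⟩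
  rw [ENNReal.tsum_add, ← one_add_one_eq_two]
  exact add_le_add h hεsum.le

theorem modular_div_two_rpow_le {e : X → ℝ} {f : X → ℝ≥0∞} {l M : ℝ≥0∞} (hp : ∀ x, 0 ≤ p x)
    (he : ∀ x, 0 ≤ e x) (heκ : ∀ᵐ x ∂μ, e x ≤ κ) (hl0 : 0 < l) (hltop : l ≠ ∞) (hM : M ≠ ∞)
    (hlM : ∀ x, (l / 2) ^ (e x * p x) ≤ M) (h : modular μ p (fun x => f x / l ^ e x) ≤ 1) :
    modular μ p (fun x => f x / 2 ^ κ) ≤ M := by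
  have hle (x : X) (hx : e x ≤ κ) : (l ^ e x / 2 ^ κ) ^ p x ≤ M :=
    calc (l ^ e x / 2 ^ κ) ^ p x ≤ ((l / 2) ^ e x) ^ p x := by
          refine ENNReal.rpow_le_rpow ?_ (hp x)
          rw [ENNReal.div_rpow_of_nonneg _ _ (he x)]
          exact ENNReal.div_le_div_left
            (ENNReal.rpow_le_rpow_of_exponent_le one_le_two hx) _
      _ = (l / 2) ^ (e x * p x) := (ENNReal.rpow_mul _ _ _).symm
      _ ≤ M := hlM x
  calc modular μ p (fun x => f x / 2 ^ κ)
      = modular μ p fun x => l ^ e x / 2 ^ κ * (f x / l ^ e x) := by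
        congr 1 with x
        have h0 : l ^ e x ≠ 0 := (ENNReal.rpow_pos hl0 hltop).ne'
        have htop : l ^ e x ≠ ∞ := ENNReal.rpow_ne_top_of_nonneg (he x) hltop
        rw [mul_comm, ← mul_div_assoc, ENNReal.div_mul_cancel h0 htop]
    _ ≤ M * modular μ p (fun x => f x / l ^ e x) := modular_mul_le hp hM (heκ.mono hle)
    _ ≤ M := mul_le_of_le_one_right' h

theorem modular_div_two_rpow_le_one (hp : ∀ x, 0 ≤ p x) (hqκ : ∀ᵐ x ∂μ, (q x)⁻¹.toReal ≤ κ)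
    (h : seqLpModular μ p q g ≤ 1) (k : ℤ) : modular μ p (fun x => g k x / 2 ^ κ) ≤ 1 := by
  obtain ⟨l, hl0, hlsum, hl⟩ := exists_scales_of_seqLpModular_le_one h
  have hl2 : l k ≤ 2 := (ENNReal.le_tsum k).trans hlsum
  refine modular_div_two_rpow_le hp (fun _ => ENNReal.toReal_nonneg) hqκ (hl0 k)
    (hl2.trans_lt ENNReal.ofNat_lt_top).ne ENNReal.one_ne_top (fun x => ?_) (hl k)
  exact ENNReal.rpow_le_one (ENNReal.div_le_of_le_mul (by rwa [one_mul]))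
    (mul_nonneg ENNReal.toReal_nonneg (hp x))

theorem modular_iSup_div_two_rpow_le_one (hpm : Measurable p) (hp : ∀ x, 0 < p x)
    (hq : ∀ x, 0 < q x) (hqp : ∀ x, q x ≤ ENNReal.ofReal (p x))
    (hqκ : ∀ᵐ x ∂μ, (q x)⁻¹.toReal ≤ κ) (hg : ∀ k, Measurable (g k))
    (h : seqLpModular μ p q g ≤ 1) : modular μ p (fun x => (⨆ k, g k x) / 2 ^ κ) ≤ 1 := by
  obtain ⟨l, hl0, hlsum, hl⟩ := exists_scales_of_seqLpModular_le_one h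
  have hl2 (k : ℤ) : l k ≤ 2 := (ENNReal.le_tsum k).trans hlsum
  have hl1 (k : ℤ) : l k / 2 ≤ 1 := ENNReal.div_le_of_le_mul (by rw [one_mul]; exact hl2 k)
  have hone (x : X) : 1 ≤ (q x)⁻¹.toReal * p x := by
    have hinv : (p x)⁻¹ ≤ (q x)⁻¹.toReal := by
      rw [← ENNReal.toReal_ofReal (inv_nonneg.2 (hp x).le), ENNReal.ofReal_inv_of_pos (hp x)]
      exact ENNReal.toReal_mono (ENNReal.inv_ne_top.2 (hq x).ne') (ENNReal.inv_le_inv.2 (hqp x))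
    exact (inv_le_iff_one_le_mul₀ (hp x)).1 hinv
  have hterm (k : ℤ) : modular μ p (fun x => g k x / 2 ^ κ) ≤ l k / 2 :=
    modular_div_two_rpow_le (fun x => (hp x).le) (fun _ => ENNReal.toReal_nonneg) hqκ (hl0 k)
      ((hl2 k).trans_lt ENNReal.ofNat_lt_top).ne ((hl1 k).trans_lt ENNReal.one_lt_top).ne
      (fun x => by simpa only [ENNReal.rpow_one] using
        ENNReal.rpow_le_rpow_of_exponent_ge (hl1 k) (hone x)) (hl k)
  simp only [ENNReal.iSup_div]
  calc modular μ p (fun x => ⨆ k, g k x / 2 ^ κ) ≤ ∑' k, modular μ p fun x => g k x / 2 ^ κ :=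
        modular_iSup_le hpm hp fun k => (hg k).div_const _
    _ ≤ ∑' k, l k / 2 := ENNReal.tsum_le_tsum hterm
    _ = (∑' k, l k) / 2 := by simp only [div_eq_mul_inv, ENNReal.tsum_mul_right]
    _ ≤ 1 := ENNReal.div_le_of_le_mul (by rwa [one_mul])

theorem lpNorm_le_mul_seqLpNorm {h : X → ℝ≥0∞} {D : ℝ≥0∞} (hD0 : D ≠ 0) (hDtop : D ≠ ∞)
    (H : ∀ l, seqLpModular μ p q (fun k x => g k x / l) ≤ 1 →
      modular μ p (fun x => h x / l / D) ≤ 1) :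
    lpNorm μ p h ≤ D * seqLpNorm μ p q g := by
  rw [← ENNReal.div_le_iff' hD0 hDtop]
  refine le_sInf fun l ⟨hl0, hltop, hl⟩ => ?_
  rw [ENNReal.div_le_iff' hD0 hDtop]
  refine sInf_le ⟨ENNReal.mul_pos hD0 hl0.ne', ENNReal.mul_lt_top hDtop.lt_top hltop, ?_⟩
  convert H l hl using 3 with x
  rw [div_eq_mul_inv, div_eq_mul_inv, div_eq_mul_inv, ENNReal.mul_inv (.inl hD0) (.inl hDtop),
    mul_comm D⁻¹, mul_assoc]

theorem lpNorm_iSup_le_seqLpNorm (hpm : Measurable p) (hp : ∀ x, 0 < p x) (hq : ∀ x, 0 < q x)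
    (hqp : ∀ x, q x ≤ ENNReal.ofReal (p x)) (hκ : 0 ≤ κ) (hqκ : ∀ᵐ x ∂μ, (q x)⁻¹.toReal ≤ κ)
    (hg : ∀ k, Measurable (g k)) :
    lpNorm μ p (fun x => ⨆ k, g k x) ≤ 2 ^ κ * seqLpNorm μ p q g := by
  refine lpNorm_le_mul_seqLpNorm (ENNReal.rpow_pos two_pos ENNReal.ofNat_ne_top).ne'
    (ENNReal.rpow_ne_top_of_nonneg hκ ENNReal.ofNat_ne_top) fun l hl => ?_
  simpa only [ENNReal.iSup_div] using
    modular_iSup_div_two_rpow_le_one hpm hp hq hqp hqκ (fun k => (hg k).div_const l) hl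

theorem lpNorm_iSup_pow_mul_le_seqLpNorm {τ : ℝ≥0∞} (hpm : Measurable p) (hc : 0 < c)
    (hcp : ∀ x, c ≤ p x) (hκ : 0 ≤ κ) (hqκ : ∀ᵐ x ∂μ, (q x)⁻¹.toReal ≤ κ) (hτ : τ < 1)
    (hg : ∀ k, Measurable (g k)) :
    lpNorm μ p (fun x => ⨆ k : ℕ, τ ^ k * g k x) ≤
      2 ^ κ * ((1 - τ ^ c)⁻¹) ^ c⁻¹ * seqLpNorm μ p q g := by
  have hone : 1 ≤ (1 - τ ^ c)⁻¹ := ENNReal.one_le_inv.2 tsub_le_self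
  have htop : (1 - τ ^ c)⁻¹ ≠ ∞ :=
    ENNReal.inv_ne_top.2 (tsub_pos_of_lt (ENNReal.rpow_lt_one hτ hc)).ne'
  have h2 : (2 : ℝ≥0∞) ^ κ ≠ 0 := (ENNReal.rpow_pos two_pos ENNReal.ofNat_ne_top).ne'
  have h2top : (2 : ℝ≥0∞) ^ κ ≠ ∞ := ENNReal.rpow_ne_top_of_nonneg hκ ENNReal.ofNat_ne_top
  refine lpNorm_le_mul_seqLpNorm
    (mul_ne_zero h2 (ENNReal.rpow_pos (one_pos.trans_le hone) htop).ne')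
    (ENNReal.mul_ne_top h2top (ENNReal.rpow_ne_top_of_nonneg (inv_nonneg.2 hc.le) htop))
    fun l hl => ?_
  have hmod := modular_div_rpow_le_one hc hcp hone <| modular_iSup_pow_mul_le hpm hc hcp hτ.le
    (fun k : ℕ => ((hg k).div_const l).div_const _)
    fun k => modular_div_two_rpow_le_one (fun x => hc.le.trans (hcp x)) hqκ hl k
  simpa only [div_eq_mul_inv, ENNReal.mul_inv (.inl h2) (.inl h2top), ENNReal.iSup_mul,
    mul_assoc] using hmod

end MixedNorms

section LocalGradients

variable [MetricSpace X] [MeasurableSpace X] {μ : Measure X} {s t : X → ℝ} {u : X → EReal}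
  {g : ℤ → X → ℝ≥0∞} {h : X → ℝ≥0∞}

/-- `h` is a scalar Hajłasz `s(·)`-gradient of `u` at distances less than `1`: a single function
which takes the place of a sequence in `vectorGradients μ s u`. -/
structure IsLocalGradient (μ : Measure X) (s : X → ℝ) (u : X → EReal) (h : X → ℝ≥0∞) : Prop where
  measurable : Measurable h
  exists_ae_le : ∃ G : Set X, (∀ᵐ x ∂μ, x ∈ G) ∧
    ∀ ⦃x⦄, x ∈ G → ∀ ⦃y⦄, y ∈ G → 0 < dist x y → dist x y < 1 →
      (u x - u y).abs ≤
        ENNReal.ofReal (dist x y ^ s x) * h x + ENNReal.ofReal (dist x y ^ s y) * h y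

theorem exists_dyadic_scale {d : ℝ} (hd : 0 < d) (hd1 : d < 1) :
    ∃ k : ℕ, (2 : ℝ) ^ (-(k : ℤ) - 1) ≤ d ∧ d < (2 : ℝ) ^ (-(k : ℤ)) := by
  obtain ⟨n, hn, hn'⟩ := exists_mem_Ico_zpow hd one_lt_two
  have hneg : n < 0 := by
    by_contra! hcon
    linarith [one_le_zpow₀ (one_le_two (α := ℝ)) hcon]
  lift -n - 1 to ℕ using (by omega) with k hk
  obtain rfl : n = -(k : ℤ) - 1 := by omega
  exact ⟨k, hn, by rwa [sub_add_cancel] at hn'⟩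

theorem ofReal_rpow_le_mul_pow {d σ θ δ : ℝ} {k : ℕ} (hd : 0 < d) (hdk : d ≤ 2 ^ (-(k : ℤ)))
    (hδ : 0 ≤ δ) (hδσ : δ ≤ σ - θ) :
    ENNReal.ofReal (d ^ σ) ≤ ENNReal.ofReal (d ^ θ) * ((2⁻¹ : ℝ≥0∞) ^ δ) ^ k := by
  have hd1 : d ≤ 1 := hdk.trans (zpow_le_one_of_nonpos₀ one_le_two (by simp))
  have htwo : (2⁻¹ : ℝ≥0∞) = ENNReal.ofReal 2⁻¹ := by
    rw [ENNReal.ofReal_inv_of_pos two_pos, ENNReal.ofReal_ofNat]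
  rw [htwo, ENNReal.ofReal_rpow_of_pos (by norm_num), ← ENNReal.ofReal_pow (by positivity),
    ← ENNReal.ofReal_mul (by positivity)]
  refine ENNReal.ofReal_le_ofReal ?_
  calc d ^ σ ≤ d ^ (θ + δ) := Real.rpow_le_rpow_of_exponent_ge hd hd1 (by linarith)
    _ = d ^ θ * d ^ δ := Real.rpow_add hd θ δ
    _ ≤ d ^ θ * (2 ^ (-(k : ℤ))) ^ δ := by gcongr
    _ = d ^ θ * ((2⁻¹ : ℝ) ^ δ) ^ k := by
      rw [zpow_neg, zpow_natCast, ← inv_pow, Real.rpow_pow_comm (by norm_num)]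

theorem isLocalGradient_iSup_pow_mul {δ : ℝ} (hg : g ∈ vectorGradients μ s u) (hδ : 0 ≤ δ)
    (hst : ∀ᵐ x ∂μ, δ ≤ s x - t x) :
    IsLocalGradient μ t u fun x => ⨆ k : ℕ, ((2⁻¹ : ℝ≥0∞) ^ δ) ^ k * g k x := by
  obtain ⟨hgm, N, hN, hgrad⟩ := hg
  refine ⟨.iSup fun k => (hgm k).const_mul _, {x | x ∉ N ∧ δ ≤ s x - t x},
    (measure_eq_zero_iff_ae_notMem.1 hN).and hst, fun x hx y hy hd hd1 => ?_⟩
  obtain ⟨k, hk, hk'⟩ := exists_dyadic_scale hd hd1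
  have hterm (z : X) (hz : δ ≤ s z - t z) : ENNReal.ofReal (dist x y ^ s z) * g k z ≤
      ENNReal.ofReal (dist x y ^ t z) * ⨆ j : ℕ, ((2⁻¹ : ℝ≥0∞) ^ δ) ^ j * g j z :=
    calc ENNReal.ofReal (dist x y ^ s z) * g k z
        ≤ ENNReal.ofReal (dist x y ^ t z) * ((2⁻¹ : ℝ≥0∞) ^ δ) ^ k * g k z := by
          gcongr
          exact ofReal_rpow_le_mul_pow hd hk'.le hδ hz
      _ = ENNReal.ofReal (dist x y ^ t z) * (((2⁻¹ : ℝ≥0∞) ^ δ) ^ k * g k z) := mul_assoc _ _ _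
      _ ≤ _ := by
        gcongr
        exact le_iSup (fun j : ℕ => ((2⁻¹ : ℝ≥0∞) ^ δ) ^ j * g j z) k
  exact (hgrad k x y hx.1 hy.1 hk hk').trans (add_le_add (hterm x hx.2) (hterm y hy.2))

theorem isLocalGradient_iSup (hg : g ∈ vectorGradients μ s u) :
    IsLocalGradient μ s u fun x => ⨆ k : ℕ, g k x := by
  simpa only [ENNReal.rpow_zero, one_pow, one_mul] using
    isLocalGradient_iSup_pow_mul (t := s) hg le_rfl (.of_forall fun x => (sub_self (s x)).ge)

theorem measurable_ereal_abs : Measurable EReal.abs :=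
  EReal.measurable_of_measurable_real (ENNReal.measurable_ofReal.comp measurable_id.abs)

theorem toReal_ereal_abs (a : EReal) : a.abs.toReal = |a.toReal| := by
  induction a <;> simp [EReal.abs_def]

theorem IsLocalGradient.exists_isHajlaszGradientOn (hh : IsLocalGradient μ s u h)
    (hu : ∀ᵐ x ∂μ, u x ≠ ⊤ ∧ u x ≠ ⊥) (hhtop : ∀ᵐ x ∂μ, h x ≠ ∞) :
    ∃ G : Set X, (∀ᵐ x ∂μ, x ∈ G) ∧ (∀ x ∈ G, ((u x).toReal : EReal) = u x) ∧
      IsHajlaszGradientOn s (fun x => (u x).toReal) (fun x => (h x).toReal) G := by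
  obtain ⟨-, G, hG, hgrad⟩ := hh
  refine ⟨{x | x ∈ G ∧ (u x ≠ ⊤ ∧ u x ≠ ⊥) ∧ h x ≠ ∞}, hG.and (hu.and hhtop),
    fun x hx => EReal.coe_toReal hx.2.1.1 hx.2.1.2, fun x hx y hy hd => ?_⟩
  rcases eq_or_ne x y with rfl | hne
  · rw [sub_self, abs_zero]
    positivity
  have hle := hgrad hx.1 hy.1 (dist_pos.2 hne) hd
  rw [← EReal.coe_toReal hx.2.1.1 hx.2.1.2, ← EReal.coe_toReal hy.2.1.1 hy.2.1.2,
    ← EReal.coe_sub, EReal.abs_def, ← ENNReal.ofReal_toReal hx.2.2,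
    ← ENNReal.ofReal_toReal hy.2.2, ← ENNReal.ofReal_mul (by positivity),
    ← ENNReal.ofReal_mul (by positivity), ← ENNReal.ofReal_add (by positivity) (by positivity)]
    at hle
  exact (ENNReal.ofReal_le_ofReal_iff (by positivity)).1 hle

end LocalGradients

section Embeddings

variable [MetricSpace X] [MeasurableSpace X] {μ : Measure X} {Q p s t : X → ℝ} {q : X → ℝ≥0∞}

theorem toReal_le_mul_of_div_le {a : ℝ≥0∞} {B : ℝ} {L : ℝ≥0} (hL : L ≠ 0) (hB : 0 ≤ B)
    (h : a / L ≤ ENNReal.ofReal B) : a.toReal ≤ L * B := by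
  refine ENNReal.toReal_le_of_le_ofReal (by positivity) ?_
  rwa [ENNReal.ofReal_mul L.coe_nonneg, ENNReal.ofReal_coe_nnreal,
    ← ENNReal.div_le_iff' (ENNReal.coe_ne_zero.2 hL) ENNReal.coe_ne_top]

theorem exists_isHolderWith_of_isLocalGradient (hQ : IsBddLogExponent μ Q)
    (hreg : LowerAhlforsRegular μ Q) (hp : IsBddLogExponent μ p) (hs : IsBddLogExponent μ s)
    (hsp : MuchLess μ Q fun x => s x * p x) :
    ∃ C : ℝ≥0, ∀ (u : X → EReal) (h : X → ℝ≥0∞) (L : ℝ≥0), L ≠ 0 → Measurable u →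
      (∀ᵐ x ∂μ, u x ≠ ⊤ ∧ u x ≠ ⊥) → IsLocalGradient μ s u h →
      lpNorm μ p (fun x => (u x).abs) < L → lpNorm μ p h < L →
      ∃ v : X → ℝ, (∀ᵐ x ∂μ, u x = v x) ∧ IsHolderWith (C * L) (fun x => s x - Q x / p x) v := by
  have := hreg.isOpenPosMeasure
  obtain ⟨a, ha, haα⟩ := hs.exists_le_sub_div hQ hp hsp
  obtain ⟨_, S, -, -, hsS⟩ := hs.exists_bounds
  obtain ⟨c, _, hc, -, hcp⟩ := hp.exists_bounds
  obtain ⟨A, -, hA⟩ := hQ.logHolder_self.exists_isRpowComparable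
  obtain ⟨K, hK, hpoint⟩ := hreg.exists_le_of_modular_le_one hA hp.measurable hc fun x => (hcp x).1
  obtain ⟨C, hC, hholder⟩ := exists_isHolderWith_of_good_points (hs.logHolder_sub_div hQ hp) ha haα
    (fun x => (div_pos (hQ.pos x) (hp.pos x)).le) fun x => (hsS x).2
  lift C to ℝ≥0 using hC.le
  lift K to ℝ≥0 using hK.le
  refine ⟨C * K, fun u h L hL hum hufin hh huL hhL => ?_⟩
  have hp0 (x : X) : 0 ≤ p x := (hp.pos x).le
  have hu1 := modular_div_le_one_of_lpNorm_lt hp0 huL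
  have hh1 := modular_div_le_one_of_lpNorm_lt hp0 hhL
  have hhtop : ∀ᵐ x ∂μ, h x ≠ ∞ := by
    filter_upwards [ae_ne_top_of_modular_ne_top hp.measurable hp.pos (hh.measurable.div_const _)
      (hh1.trans_lt ENNReal.one_lt_top).ne] with x hx hxtop
    exact hx (by rw [hxtop, ENNReal.top_div_of_ne_top ENNReal.coe_ne_top])
  obtain ⟨G, hG, hcoe, hgrad⟩ := hh.exists_isHajlaszGradientOn hufin hhtop
  obtain ⟨v, hv, hvC⟩ := hholder (L * K) _ _ G (by positivity) hgrad fun x r hr hr1 => by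
    obtain ⟨y, hyG, hyr, hyu, hyh⟩ := hpoint _ _ ((measurable_ereal_abs.comp hum).div_const _)
      (hh.measurable.div_const _) hu1 hh1 G hG x r hr hr1
    refine ⟨y, hyG, hyr, ?_, ?_⟩
    · rw [← toReal_ereal_abs, mul_assoc]
      exact toReal_le_mul_of_div_le hL (by positivity) hyu
    · rw [mul_assoc]
      exact toReal_le_mul_of_div_le hL (by positivity) hyh
  refine ⟨v, hG.mono fun x hx => by rw [hv x hx, hcoe x hx], ?_⟩
  rwa [mul_comm (L : ℝ), ← mul_assoc] at hvC

theorem exists_isHolderWith_of_gradient_lpNorm_le {F : (ℤ → X → ℝ≥0∞) → ℝ≥0∞} {D : ℝ≥0}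
    (hQ : IsBddLogExponent μ Q) (hreg : LowerAhlforsRegular μ Q) (hp : IsBddLogExponent μ p)
    (ht : IsBddLogExponent μ t) (htp : MuchLess μ Q fun x => t x * p x)
    (hF : ∀ u, ∀ g ∈ vectorGradients μ s u, ∃ h, IsLocalGradient μ t u h ∧ lpNorm μ p h ≤ D * F g) :
    ∃ C : ℝ≥0, ∀ (u : X → EReal) (m : ℝ≥0), Measurable u → (∀ᵐ x ∂μ, u x ≠ ⊤ ∧ u x ≠ ⊥) →
      lpNorm μ p (fun x => (u x).abs) + ⨅ g ∈ vectorGradients μ s u, F g = m →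
      ∃ v : X → ℝ, (∀ᵐ x ∂μ, u x = v x) ∧ IsHolderWith (C * m) (fun x => t x - Q x / p x) v := by
  have := hreg.isOpenPosMeasure
  obtain ⟨c, _, hc, -, hcp⟩ := hp.exists_bounds
  obtain ⟨C, hholder⟩ := exists_isHolderWith_of_isLocalGradient hQ hreg hp ht htp
  refine ⟨C * (2 * (1 + D)), fun u m hum hufin hm => ?_⟩
  rcases eq_or_ne m 0 with rfl | hm0
  · have hu0 := ae_eq_zero_of_lpNorm_eq_zero hp.measurable hc (fun x => (hcp x).1)
      (measurable_ereal_abs.comp hum) (add_eq_zero.1 hm).1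
    exact ⟨0, hu0.mono fun x hx => EReal.abs_eq_zero_iff.1 hx, by simp, by simp⟩
  have hmlt : (m : ℝ≥0∞) < (2 * m : ℝ≥0) := by
    rw [ENNReal.coe_lt_coe]
    exact lt_mul_of_one_lt_left (pos_of_ne_zero hm0) one_lt_two
  obtain ⟨g, hg, hgm⟩ : ∃ g ∈ vectorGradients μ s u, F g < (2 * m : ℝ≥0) := by
    simpa only [iInf_lt_iff, exists_prop] using (le_add_self.trans_eq hm).trans_lt hmlt
  obtain ⟨h, hh, hhF⟩ := hF u g hg
  have hL : 2 * (1 + D) * m = 2 * m + D * (2 * m) := by ring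
  have huL : lpNorm μ p (fun x => (u x).abs) < (2 * (1 + D) * m : ℝ≥0) :=
    calc lpNorm μ p (fun x => (u x).abs) ≤ m := le_self_add.trans_eq hm
      _ < (2 * m : ℝ≥0) := hmlt
      _ ≤ (2 * (1 + D) * m : ℝ≥0) := by rw [hL]; exact ENNReal.coe_le_coe.2 le_self_add
  have hhL : lpNorm μ p h < (2 * (1 + D) * m : ℝ≥0) :=
    calc lpNorm μ p h ≤ D * F g := hhF
      _ ≤ (D * (2 * m) : ℝ≥0) := by rw [ENNReal.coe_mul]; gcongr
      _ < (2 * (1 + D) * m : ℝ≥0) := by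
        rw [hL, ENNReal.coe_lt_coe]
        exact lt_add_of_pos_left _ (by positivity)
  simpa only [NNReal.coe_mul, mul_assoc] using hholder u h _ (by positivity) hum hufin hh huL hhL

theorem embedsInHolder_of_gradient_lpNorm_le {F : (ℤ → X → ℝ≥0∞) → ℝ≥0∞} {D : ℝ≥0}
    (hQ : IsBddLogExponent μ Q) (hreg : LowerAhlforsRegular μ Q) (hp : IsBddLogExponent μ p)
    (ht : IsBddLogExponent μ t) (htp : MuchLess μ Q fun x => t x * p x)
    (hF : ∀ u, ∀ g ∈ vectorGradients μ s u, ∃ h, IsLocalGradient μ t u h ∧ lpNorm μ p h ≤ D * F g) :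
    EmbedsInHolder μ
      ({u | Measurable u ∧ (∀ᵐ x ∂μ, u x ≠ ⊤ ∧ u x ≠ ⊥) ∧ ⨅ g ∈ vectorGradients μ s u, F g < ∞} ∩
        LpSpace μ p)
      (fun u => lpNorm μ p (fun x => (u x).abs) + ⨅ g ∈ vectorGradients μ s u, F g)
      (fun x => t x - Q x / p x) := by
  have := hreg.isOpenPosMeasure
  obtain ⟨a, ha, haα⟩ := ht.exists_le_sub_div hQ hp htp
  obtain ⟨_, S, -, -, htS⟩ := ht.exists_bounds
  obtain ⟨c, _, hc, -, hcp⟩ := hp.exists_bounds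
  obtain ⟨C, hholder⟩ := exists_isHolderWith_of_gradient_lpNorm_le hQ hreg hp ht htp hF
  have hα (x : X) : 0 < t x - Q x / p x := ha.trans_le (haα x)
  refine ⟨fun x => (hα x).le, ⟨S, ?_⟩, 2 * C, ?_⟩
  · rintro _ ⟨x, rfl⟩
    exact (sub_le_self _ (div_pos (hQ.pos x) (hp.pos x)).le).trans (htS x).2
  rintro u ⟨⟨hum, hufin, hgrad⟩, -, hmod⟩
  have hlp := lpNorm_lt_top_of_modular_lt_top hc (fun x => (hcp x).1) hmod
  obtain ⟨m, hm, -⟩ := ENNReal.lt_iff_exists_coe.1 (ENNReal.add_lt_top.2 ⟨hlp, hgrad⟩)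
  obtain ⟨v, huv, hv⟩ := hholder u m hum hufin hm
  have hnorm : holderNorm (fun x => t x - Q x / p x) v ≤ (2 * C : ℝ≥0) * m := by
    refine hv.holderNorm_le.trans_eq ?_
    rw [← NNReal.coe_mul, ENNReal.ofReal_coe_nnreal, ENNReal.coe_mul, ENNReal.coe_mul,
      ENNReal.coe_ofNat, mul_assoc]
  refine ⟨v, ⟨hv.continuous hα, ?_⟩, huv, hnorm.trans_eq (by rw [← hm])⟩
  exact hnorm.trans_lt (ENNReal.mul_lt_top ENNReal.coe_lt_top ENNReal.coe_lt_top)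

theorem triebelLizorkin_embedsInHolder (hQ : IsBddLogExponent μ Q)
    (hreg : LowerAhlforsRegular μ Q) (hp : IsBddLogExponent μ p) (hs : IsBddLogExponent μ s)
    (hsp : MuchLess μ Q fun x => s x * p x) (hq : ∀ x, 0 < q x) :
    EmbedsInHolder μ (TriebelLizorkin μ s p q) (triebelLizorkinNorm μ s p q)
      fun x => s x - Q x / p x := by
  refine embedsInHolder_of_gradient_lpNorm_le (F := lpSeqNorm μ p q) (D := 1) hQ hreg hp hs hsp
    fun u g hg => ⟨_, isLocalGradient_iSup hg, ?_⟩
  rw [ENNReal.coe_one, one_mul]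
  exact lpNorm_iSup_le_lpSeqNorm (fun x => (hp.pos x).le) hq

theorem besov_embedsInHolder_of_le (hQ : IsBddLogExponent μ Q) (hreg : LowerAhlforsRegular μ Q)
    (hp : IsBddLogExponent μ p) (hs : IsBddLogExponent μ s)
    (hsp : MuchLess μ Q fun x => s x * p x) (hq : IsExponent μ q)
    (hqp : ∀ x, q x ≤ ENNReal.ofReal (p x)) :
    EmbedsInHolder μ (Besov μ s p q) (besovNorm μ s p q) fun x => s x - Q x / p x := by
  obtain ⟨κ, hκ, hqκ⟩ := hq.exists_inv_le
  obtain ⟨D, hD, -⟩ := ENNReal.lt_iff_exists_coe.1 <|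
    ENNReal.rpow_lt_top_of_nonneg hκ (ENNReal.ofNat_ne_top (n := 2))
  refine embedsInHolder_of_gradient_lpNorm_le (F := seqLpNorm μ p q) (D := D) hQ hreg hp hs hsp
    fun u g hg => ⟨_, isLocalGradient_iSup hg, ?_⟩
  rw [← hD]
  exact (lpNorm_mono (fun x => (hp.pos x).le) fun x => iSup_comp_le (fun k : ℤ => g k x) _).trans
    (lpNorm_iSup_le_seqLpNorm hp.measurable hp.pos hq.pos hqp hκ hqκ hg.1)

theorem besov_embedsInHolder_of_muchLess (hQ : IsBddLogExponent μ Q)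
    (hreg : LowerAhlforsRegular μ Q) (hp : IsBddLogExponent μ p) (ht : IsBddLogExponent μ t)
    (htp : MuchLess μ Q fun x => t x * p x)
    (htsp : MuchLess μ (fun x => t x * p x) fun x => s x * p x) (hq : IsExponent μ q) :
    EmbedsInHolder μ (Besov μ s p q) (besovNorm μ s p q) fun x => t x - Q x / p x := by
  have := hreg.isOpenPosMeasure
  obtain ⟨κ, hκ, hqκ⟩ := hq.exists_inv_le
  obtain ⟨c, _, hc, -, hcp⟩ := hp.exists_bounds
  obtain ⟨δ, hδ, hst⟩ := htsp.exists_le_sub_div hp.toIsBddExponent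
  simp only [mul_div_cancel_right₀ _ (hp.pos _).ne'] at hst
  have hτ : (2⁻¹ : ℝ≥0∞) ^ δ < 1 :=
    ENNReal.rpow_lt_one (ENNReal.inv_lt_one.2 ENNReal.one_lt_two) hδ
  have hinv : (1 - ((2⁻¹ : ℝ≥0∞) ^ δ) ^ c)⁻¹ ≠ ∞ :=
    ENNReal.inv_ne_top.2 (tsub_pos_of_lt (ENNReal.rpow_lt_one hτ hc)).ne'
  obtain ⟨D, hD, -⟩ := ENNReal.lt_iff_exists_coe.1 <| ENNReal.mul_lt_top
    (ENNReal.rpow_lt_top_of_nonneg hκ (ENNReal.ofNat_ne_top (n := 2)))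
    (ENNReal.rpow_lt_top_of_nonneg (inv_nonneg.2 hc.le) hinv)
  refine embedsInHolder_of_gradient_lpNorm_le (F := seqLpNorm μ p q) (D := D) hQ hreg hp ht htp
    fun u g hg => ⟨_, isLocalGradient_iSup_pow_mul hg hδ.le hst, ?_⟩
  rw [← hD]
  exact lpNorm_iSup_pow_mul_le_seqLpNorm hp.measurable hc (fun x => (hcp x).1) hκ hqκ hτ hg.1

end Embeddings

end VarExp

theorem mainTheorem8_general {X : Type*} [MetricSpace X] [MeasurableSpace X] {μ : Measure X}
    {Q p : X → ℝ} (hQ : VarExp.IsBddLogExponent μ Q) (hreg : VarExp.LowerAhlforsRegular μ Q)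
    (hp : VarExp.IsBddLogExponent μ p) :
    (∀ (q : X → ℝ≥0∞) (s : X → ℝ), (∀ x, 0 < q x) → VarExp.IsBddLogExponent μ s →
      VarExp.MuchLess μ Q (fun x => s x * p x) →
      VarExp.EmbedsInHolder μ (VarExp.TriebelLizorkin μ s p q)
        (VarExp.triebelLizorkinNorm μ s p q) (fun x => s x - Q x / p x)) ∧
    (∀ (q : X → ℝ≥0∞) (s : X → ℝ), VarExp.IsExponent μ q → (∀ x, q x ≤ ENNReal.ofReal (p x)) →
      VarExp.IsBddLogExponent μ s → VarExp.MuchLess μ Q (fun x => s x * p x) →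
      VarExp.EmbedsInHolder μ (VarExp.Besov μ s p q)
        (VarExp.besovNorm μ s p q) (fun x => s x - Q x / p x)) ∧
    (∀ (q : X → ℝ≥0∞) (s t : X → ℝ), VarExp.IsExponent μ q → VarExp.IsBddLogExponent μ t →
      VarExp.MuchLess μ Q (fun x => t x * p x) →
      VarExp.MuchLess μ (fun x => t x * p x) (fun x => s x * p x) →
      VarExp.EmbedsInHolder μ (VarExp.Besov μ s p q)
        (VarExp.besovNorm μ s p q) (fun x => t x - Q x / p x)) :=
  ⟨fun _ _ hq hs hsp => VarExp.triebelLizorkin_embedsInHolder hQ hreg hp hs hsp hq,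
    fun _ _ hq hqp hs hsp => VarExp.besov_embedsInHolder_of_le hQ hreg hp hs hsp hq hqp,
    fun _ _ _ hq ht htp htsp => VarExp.besov_embedsInHolder_of_muchLess hQ hreg hp ht htp htsp hq⟩

theorem mainTheorem8 {X : Type*} [MetricSpace X] [MeasurableSpace X] [BorelSpace X]
    (μ : MeasureTheory.Measure X) (hμ : VarExp.IsMetricMeasure μ)
    (Q p s : X → ℝ)
    (hQ : VarExp.IsBddLogExponent μ Q) (hreg : VarExp.LowerAhlforsRegular μ Q)
    (hp : VarExp.IsBddLogExponent μ p) (hs : VarExp.IsBddLogExponent μ s)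
    (hsp : VarExp.MuchLess μ Q (fun x => s x * p x)) :
    (∀ q : X → ENNReal, VarExp.IsExponent μ q →
      VarExp.EmbedsInHolder μ (VarExp.TriebelLizorkin μ s p q)
        (VarExp.triebelLizorkinNorm μ s p q) (fun x => s x - Q x / p x)) ∧
    (∀ q : X → ENNReal, VarExp.IsExponent μ q → (∀ x, q x ≤ ENNReal.ofReal (p x)) →
      VarExp.EmbedsInHolder μ (VarExp.Besov μ s p q)
        (VarExp.besovNorm μ s p q) (fun x => s x - Q x / p x)) ∧
    (∀ (q : X → ENNReal) (t : X → ℝ), VarExp.IsExponent μ q → VarExp.IsBddLogExponent μ t →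
      VarExp.MuchLess μ Q (fun x => t x * p x) →
      VarExp.MuchLess μ (fun x => t x * p x) (fun x => s x * p x) →
      VarExp.EmbedsInHolder μ (VarExp.Besov μ s p q)
        (VarExp.besovNorm μ s p q) (fun x => t x - Q x / p x)) := by
  obtain ⟨hM, hN, hNt⟩ := mainTheorem8_general hQ hreg hp
  exact ⟨fun q hq => hM q s hq.pos hs hsp, fun q hq hqp => hN q s hq hqp hs hsp,
    fun q t hq => hNt q s t hq⟩
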